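/- Let $\Bbbk$ be a field of characteristic zero and $n\ge 1$ an integer. Let $\overline\Gamma_n$ be the quiver with vertices $\{1,2\}$ and arrows $a_i:1\to2$, $b_i:2\to1$ ($1\le i\le n$). Let $\Bbbk\overline\Gamma_n$ be its path algebra, generated by the $a_i,b_i$ and orthogonal idempotents $e_1,e_2$ subject to $e_1+e_2=1$, $a_i=e_2a_ie_1$, $b_i=e_1b_ie_2$, and put $B=\Bbbk e_1\oplus\Bbbk e_2$. For alternating words in the $a$'s and $b$'s, Euler continuants are defined by $(y_1)=y_1$, $(a_i,b_j)=e_2+a_ib_j$, $(b_i,a_j)=e_1+b_ia_j$, and $(y_1,\dots,y_m)=(y_1,\dots,y_{m-1})y_m+(y_1,\dots,y_{m-2})$ for $m\ge3$. The Boalch algebra $\mathcal B(\Gamma_n)$ is obtained from $\Bbbk\overline\Gamma_n$ by adjoining an inverse of $(a_1,b_1,\dots,a_n,b_n)$ in $e_2\mathcal B(\Gamma_n)e_2$ and an inverse of $(b_n,a_n,\dots,b_1,a_1)$ in $e_1\mathcal B(\Gamma_n)e_1$. A $B$-linear double bracket on a $B$-algebra $A$ is a $\Bbbk$-bilinear map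 $\{\!\{-,-\}\!\}:A\times A\to A\otimes_\Bbbk A$ such that $\{\!\{a,b\}\!\}=-\tau_{(12)}\{\!\{b,a\}\!\}$, where $\tau_{(12)}$ is the flip, $\{\!\{a,bc\}\!\}=\{\!\{a,b\}\!\}c+b\{\!\{a,c\}\!\}$, where $b(x\otimes y)c=bx\otimes yc$, and $\{\!\{a,e\}\!\}=0$ for $e\in B$. Its triple bracket is $$\{\!\{a,b,c\}\!\}=\{\!\{a,\{\!\{b,c\}\!\}\}\!\}_L+\tau_{(123)}\{\!\{b,\{\!\{c,a\}\!\}\}\!\}_L+\tau_{(132)}\{\!\{c,\{\!\{a,b\}\!\}\}\!\}_L,$$ where $\{\!\{a,b\otimes c\}\!\}_L=\{\!\{a,b\}\!\}\otimes c$, $\tau_{(123)}(x\otimes y\otimes z)=z\otimes x\otimes y$ and $\tau_{(132)}(x\otimes y\otimes z)=y\otimes z\otimes x$. When $1=\sum_s e_s$ is a finite decomposition into orthogonal idempotents and $B=\bigoplus_s\Bbbk e_s$, the double bracket is quasi-Poisson if for all $a,b,c\in A$ $$\begin{aligned}\{\!\{a,b,c\}\!\}=\tfrac14\sum_s\big(&ce_sa\otimes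 e_sb\otimes e_s-ce_sa\otimes e_s\otimes be_s-ce_s\otimes ae_sb\otimes e_s+ce_s\otimes ae_s\otimes be_s\\&-e_sa\otimes e_sb\otimes e_sc+e_sa\otimes e_s\otimes be_sc+e_s\otimes ae_sb\otimes e_sc-e_s\otimes ae_s\otimes be_sc\big).\end{aligned}$$ An invertible element $\Phi=\sum_s\Phi_s$ with $\Phi_s\in e_sAe_s$ is a multiplicative moment map if, for all $a\in A$ and all $s$, $$\{\!\{\Phi_s,a\}\!\}=\tfrac12\big(ae_s\otimes\Phi_s-e_s\otimes\Phi_sa+a\Phi_s\otimes e_s-\Phi_s\otimes e_sa\big).$$ A Hamiltonian double quasi-Poisson algebra is a triple $(A,\{\!\{-,-\}\!\},\Phi)$ consisting of such an algebra, a quasi-Poisson double bracket on it, and a multiplicative moment map. **Theorem.** There is a unique $B$-linear double bracket on $\mathcal B(\Gamma_n)$ such that, for all $1\le i,j\le n$ (with $\operatorname{sgn}(m)\in\{-1,0,1\}$ the sign of $m$), $$\{\!\{a_i,a_j\}\!\}=\tfrac12\operatorname{sgn}(i-j)\,(a_i\otimes a_j+a_j\otimes a_i),\qquad \{\!\{b_i,b_j\}\!\}=\tfrac12\operatorname{sgn}(i-j)\,(b_i\otimes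 b_j+b_j\otimes b_i),$$ $$\{\!\{a_i,b_j\}\!\}=\begin{cases}\tfrac12(e_1\otimes a_ib_j+b_ja_i\otimes e_2)&i<j,\\ \tfrac12(b_ia_i\otimes e_2+e_1\otimes a_ib_i)+e_1\otimes e_2&i=j,\\ -\tfrac12(b_ja_i\otimes e_2+e_1\otimes a_ib_j)-\delta_{i-j,1}\,e_1\otimes e_2&i>j,\end{cases}$$ $$\{\!\{b_i,a_j\}\!\}=\begin{cases}\tfrac12(e_2\otimes b_ia_j+a_jb_i\otimes e_1)+\delta_{j-i,1}\,e_2\otimes e_1&i<j,\\ -\tfrac12(e_2\otimes b_ia_i+a_ib_i\otimes e_1)-e_2\otimes e_1&i=j,\\ -\tfrac12(a_jb_i\otimes e_1+e_2\otimes b_ia_j)&i>j.\end{cases}$$ With this double bracket and $$\Phi=(a_1,b_1,\dots,a_n,b_n)+(b_n,a_n,\dots,b_1,a_1)^{-1},$$ where the last inverse is taken in $e_1\mathcal B(\Gamma_n)e_1$, the triple $(\mathcal B(\Gamma_n),\{\!\{-,-\}\!\},\Phi)$ is a Hamiltonian double quasi-Poisson algebra. -/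

import Mathlib

open scoped TensorProduct

noncomputable section

namespace Boalch

/-! ### Double brackets, double quasi-Poisson algebras, multiplicative moment maps

`A` is a `k`-algebra with a finite family `e : I → A`, and `B` is the span of the `e s`. -/

section Brackets

variable (k : Type*) [Field k] {A : Type*} [Ring A] [Algebra k A]

/-- The cyclic permutation `a₁ ⊗ a₂ ⊗ a₃ ↦ a₃ ⊗ a₁ ⊗ a₂` of `A ⊗ A ⊗ A`. -/
def tau123 : A ⊗[k] A ⊗[k] A →ₗ[k] A ⊗[k] A ⊗[k] A :=
  (TensorProduct.assoc k A A A).symm.toLinearMap ∘ₗ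
    (TensorProduct.comm k (A ⊗[k] A) A).toLinearMap

/-- The cyclic permutation `a₁ ⊗ a₂ ⊗ a₃ ↦ a₂ ⊗ a₃ ⊗ a₁` of `A ⊗ A ⊗ A`. -/
def tau132 : A ⊗[k] A ⊗[k] A →ₗ[k] A ⊗[k] A ⊗[k] A :=
  (TensorProduct.comm k A (A ⊗[k] A)).toLinearMap ∘ₗ
    (TensorProduct.assoc k A A A).toLinearMap

theorem tau123_tmul (x y z : A) : tau123 k (x ⊗ₜ[k] y ⊗ₜ[k] z) = z ⊗ₜ[k] x ⊗ₜ[k] y := rfl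

theorem tau132_tmul (x y z : A) : tau132 k (x ⊗ₜ[k] y ⊗ₜ[k] z) = y ⊗ₜ[k] z ⊗ₜ[k] x := rfl

/-- A `B`-linear double bracket on `A`, where `B` is the `k`-span of the `e s`.
In the Leibniz rule, products in the algebra `A ⊗ A` express the outer bimodule structure
`b (x ⊗ y) c = (b x) ⊗ (y c)`. -/
@[ext]
structure DoubleBracket {I : Type*} (e : I → A) where
  /-- the bilinear map `(a, b) ↦ {{a, b}}` -/
  br : A →ₗ[k] A →ₗ[k] A ⊗[k] A
  cyclic_antisymm : ∀ a b : A, br a b = -(TensorProduct.comm k A A (br b a))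
  leibniz : ∀ a b c : A,
    br a (b * c) = br a b * ((1 : A) ⊗ₜ[k] c) + (b ⊗ₜ[k] (1 : A)) * br a c
  map_base : ∀ a : A, ∀ b ∈ Submodule.span k (Set.range e), br a b = 0

namespace DoubleBracket

variable {k} {I : Type*} {e : I → A}

/-- The extension `{{a, b ⊗ c}}_L = {{a, b}} ⊗ c`. -/
def brL (D : DoubleBracket k e) (a : A) : A ⊗[k] A →ₗ[k] A ⊗[k] A ⊗[k] A :=
  LinearMap.rTensor A (D.br a)

theorem brL_tmul (D : DoubleBracket k e) (a b c : A) :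
    D.brL a (b ⊗ₜ[k] c) = D.br a b ⊗ₜ[k] c := rfl

/-- The triple bracket `{{a, b, c}}` associated with a double bracket. -/
def triple (D : DoubleBracket k e) (a b c : A) : A ⊗[k] A ⊗[k] A :=
  D.brL a (D.br b c) + tau123 k (D.brL b (D.br c a)) + tau132 k (D.brL c (D.br a b))

end DoubleBracket

/-- The triple bracket `{{a, b, c}}_qP`, i.e. `1/12` of the triple bracket of the trivector
`∑ s, E_s ^ 3`, written out. -/
def tripleQP {I : Type*} [Fintype I] (e : I → A) (a b c : A) : A ⊗[k] A ⊗[k] A :=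
  (1 / 4 : k) • ∑ s,
    ((c * e s * a) ⊗ₜ[k] (e s * b) ⊗ₜ[k] e s
      - (c * e s * a) ⊗ₜ[k] e s ⊗ₜ[k] (b * e s)
      - (c * e s) ⊗ₜ[k] (a * e s * b) ⊗ₜ[k] e s
      + (c * e s) ⊗ₜ[k] (a * e s) ⊗ₜ[k] (b * e s)
      - (e s * a) ⊗ₜ[k] (e s * b) ⊗ₜ[k] (e s * c)
      + (e s * a) ⊗ₜ[k] e s ⊗ₜ[k] (b * e s * c)
      + e s ⊗ₜ[k] (a * e s * b) ⊗ₜ[k] (e s * c)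
      - e s ⊗ₜ[k] (a * e s) ⊗ₜ[k] (b * e s * c))

variable {k} {I : Type*} [Fintype I] {e : I → A}

/-- `(A, {{-,-}})` is a double quasi-Poisson algebra over `B = ⨁ s, k e_s`. -/
structure IsDoubleQuasiPoisson (D : DoubleBracket k e) : Prop where
  idempotents : CompleteOrthogonalIdempotents e
  quasiPoisson : ∀ a b c : A, D.triple a b c = tripleQP k e a b c

/-- `Φ` is a multiplicative moment map: it is invertible, `Φ = ∑ s, Φ_s` with `Φ_s ∈ e_s A e_s`,
and `{{Φ_s, a}} = 1/2 (a e_s ⊗ Φ_s - e_s ⊗ Φ_s a + a Φ_s ⊗ e_s - Φ_s ⊗ e_s a)`. -/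
def IsMultiplicativeMomentMap (D : DoubleBracket k e) (Φ : A) : Prop :=
  IsUnit Φ ∧ ∃ Φs : I → A, Φ = ∑ s, Φs s ∧ (∀ s, ∃ x : A, Φs s = e s * x * e s) ∧
    ∀ (a : A) (s : I), D.br (Φs s) a = (1 / 2 : k) •
      ((a * e s) ⊗ₜ[k] Φs s - e s ⊗ₜ[k] (Φs s * a)
        + (a * Φs s) ⊗ₜ[k] e s - Φs s ⊗ₜ[k] (e s * a))

/-- `(A, {{-,-}}, Φ)` is a Hamiltonian double quasi-Poisson algebra. -/
structure IsHamiltonianDoubleQuasiPoisson (D : DoubleBracket k e) (Φ : A) : Prop where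
  quasiPoisson : IsDoubleQuasiPoisson D
  momentMap : IsMultiplicativeMomentMap D Φ

end Brackets

/-! ### Euler continuants -/

section Continuants

variable {R : Type*} [Ring R]

/-- The Euler continuant of a word written backwards:
`(y₁,…,y_m) = (y₁,…,y_{m-1}) y_m + (y₁,…,y_{m-2})`, with the empty continuant equal to `u`,
so that `(y₁, y₂) = u + y₁ y₂`. -/
def continuantRev (u : R) : List R → R
  | [] => u
  | [y] => y
  | y :: z :: l => continuantRev u (z :: l) * y + continuantRev u l

/-- The Euler continuant `(y₁,…,y_m)`, where `u` plays the role of the idempotent at the head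
of `y₁`. -/
def continuant (u : R) (l : List R) : R := continuantRev u l.reverse

variable {n : ℕ}

/-- The `2n`-th Euler continuant `(a₁, b₁, …, a_n, b_n)`, with `u = e₂`. -/
def continuantAB (u : R) (a b : Fin n → R) : R :=
  continuant u ((List.finRange n).flatMap fun i => [a i, b i])

/-- The `2n`-th Euler continuant `(b_n, a_n, …, b₁, a₁)`, with `u = e₁`. -/
def continuantBA (u : R) (a b : Fin n → R) : R :=
  continuant u ((List.finRange n).reverse.flatMap fun i => [b i, a i])

theorem map_continuantRev {S : Type*} [Ring S] (f : R →+* S) (u : R) :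
    ∀ l : List R, f (continuantRev u l) = continuantRev (f u) (l.map f)
  | [] => rfl
  | [y] => rfl
  | y :: z :: l => by
      simp only [continuantRev, List.map_cons, map_add, map_mul]
      rw [map_continuantRev f u (z :: l), map_continuantRev f u l, List.map_cons]

theorem map_continuantAB {S : Type*} [Ring S] (f : R →+* S) (u : R) (a b : Fin n → R) :
    f (continuantAB u a b) = continuantAB (f u) (fun i => f (a i)) (fun i => f (b i)) := by
  simp [continuantAB, continuant, map_continuantRev, List.map_flatMap]

theorem map_continuantBA {S : Type*} [Ring S] (f : R →+* S) (u : R) (a b : Fin n → R) :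
    f (continuantBA u a b) = continuantBA (f u) (fun i => f (a i)) (fun i => f (b i)) := by
  simp [continuantBA, continuant, map_continuantRev, List.map_flatMap]

end Continuants

/-! ### The path algebra of the doubled quiver

The vertices `1, 2` are `0, 1 : Fin 2`; the arrows `a_i : 1 → 2` and `b_i : 2 → 1` are indexed
by `i : Fin n` (so `a_1` is `a 0`, and so on).  Paths are read from right to left. -/

/-- Generators of the path algebra: the two idempotents and the `2n` arrows. -/
inductive PathGen (n : ℕ) : Type
  | e (s : Fin 2) : PathGen n
  | a (i : Fin n) : PathGen n
  | b (i : Fin n) : PathGen n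

section Algebras

variable (k : Type*) [Field k] (n : ℕ)

/-- Relations of the path algebra: `e_s e_t = δ_{st} e_s`, `e₁ + e₂ = 1`, `a_i = e₂ a_i e₁`,
`b_i = e₁ b_i e₂`. -/
inductive PathRel : FreeAlgebra k (PathGen n) → FreeAlgebra k (PathGen n) → Prop
  | e_mul (s t : Fin 2) : PathRel
      (FreeAlgebra.ι k (PathGen.e s) * FreeAlgebra.ι k (PathGen.e t))
      (if s = t then FreeAlgebra.ι k (PathGen.e s) else 0)
  | e_sum : PathRel
      (FreeAlgebra.ι k (PathGen.e 0) + FreeAlgebra.ι k (PathGen.e 1)) 1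
  | a_ends (i : Fin n) : PathRel
      (FreeAlgebra.ι k (PathGen.a i))
      (FreeAlgebra.ι k (PathGen.e 1) * FreeAlgebra.ι k (PathGen.a i) *
        FreeAlgebra.ι k (PathGen.e 0))
  | b_ends (i : Fin n) : PathRel
      (FreeAlgebra.ι k (PathGen.b i))
      (FreeAlgebra.ι k (PathGen.e 0) * FreeAlgebra.ι k (PathGen.b i) *
        FreeAlgebra.ι k (PathGen.e 1))

/-- The path algebra of the doubled quiver. -/
abbrev PathAlgebra : Type _ := RingQuot (PathRel k n)

/-- The class of a generator in the path algebra. -/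
def PathAlgebra.gen (x : PathGen n) : PathAlgebra k n :=
  RingQuot.mkAlgHom k (PathRel k n) (FreeAlgebra.ι k x)

/-- The Euler continuant `(a₁, b₁, …, a_n, b_n)` in the path algebra. -/
def PathAlgebra.eulerAB : PathAlgebra k n :=
  continuantAB (PathAlgebra.gen k n (.e 1)) (fun i => PathAlgebra.gen k n (.a i))
    (fun i => PathAlgebra.gen k n (.b i))

/-- The Euler continuant `(b_n, a_n, …, b₁, a₁)` in the path algebra. -/
def PathAlgebra.eulerBA : PathAlgebra k n :=
  continuantBA (PathAlgebra.gen k n (.e 0)) (fun i => PathAlgebra.gen k n (.a i))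
    (fun i => PathAlgebra.gen k n (.b i))

/-- Generators of the Boalch algebra: those of the path algebra, together with
an element `inv s` for each of the two vertices, where `inv 1` is to be the inverse of
`(a₁,…,b_n)` at the vertex `2` and `inv 0` that of `(b_n,…,a₁)` at the vertex `1`. -/
inductive BoalchGen (n : ℕ) : Type
  | path (x : PathGen n) : BoalchGen n
  | inv (s : Fin 2) : BoalchGen n

/-- The generators of the path algebra in the free algebra on `BoalchGen n`. -/
def pathVar (x : PathGen n) : FreeAlgebra k (BoalchGen n) := FreeAlgebra.ι k (BoalchGen.path x)

/-- The adjoined inverses in the free algebra on `BoalchGen n`. -/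
def invVar (s : Fin 2) : FreeAlgebra k (BoalchGen n) := FreeAlgebra.ι k (BoalchGen.inv s)

/-- The element to be inverted at each vertex, in the free algebra: `(b_n,…,a₁)` at the first
vertex and `(a₁,…,b_n)` at the second. -/
def loopVar : Fin 2 → FreeAlgebra k (BoalchGen n) :=
  ![continuantBA (pathVar k n (PathGen.e 0)) (fun i => pathVar k n (PathGen.a i))
      (fun i => pathVar k n (PathGen.b i)),
    continuantAB (pathVar k n (PathGen.e 1)) (fun i => pathVar k n (PathGen.a i))
      (fun i => pathVar k n (PathGen.b i))]

/-- Relations of the Boalch algebra: those of the path algebra, and those saying that the adjoined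
elements lie in `e_s A e_s` and are inverse there to the two Euler continuants. -/
inductive BoalchRel : FreeAlgebra k (BoalchGen n) → FreeAlgebra k (BoalchGen n) → Prop
  | path {x y : FreeAlgebra k (PathGen n)} (h : PathRel k n x y) : BoalchRel
      (FreeAlgebra.lift k (pathVar k n) x) (FreeAlgebra.lift k (pathVar k n) y)
  | e_inv (s : Fin 2) : BoalchRel (pathVar k n (PathGen.e s) * invVar k n s) (invVar k n s)
  | inv_e (s : Fin 2) : BoalchRel (invVar k n s * pathVar k n (PathGen.e s)) (invVar k n s)
  | inv_loop (s : Fin 2) : BoalchRel (invVar k n s * loopVar k n s) (pathVar k n (PathGen.e s))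
  | loop_inv (s : Fin 2) : BoalchRel (loopVar k n s * invVar k n s) (pathVar k n (PathGen.e s))

/-- The Boalch algebra: the path algebra of the doubled quiver with the Euler continuants
`(a₁,…,b_n)` and `(b_n,…,a₁)` inverted. -/
abbrev BoalchAlgebra : Type _ := RingQuot (BoalchRel k n)

namespace BoalchAlgebra

/-- The class of a generator in the Boalch algebra. -/
def gen (x : BoalchGen n) : BoalchAlgebra k n :=
  RingQuot.mkAlgHom k (BoalchRel k n) (FreeAlgebra.ι k x)

/-- The idempotents: `e 0` and `e 1` are the idempotents `e₁` and `e₂`. -/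
def e (s : Fin 2) : BoalchAlgebra k n := gen k n (.path (.e s))

/-- The arrows `a_i`. -/
def a (i : Fin n) : BoalchAlgebra k n := gen k n (.path (.a i))

/-- The arrows `b_i`. -/
def b (i : Fin n) : BoalchAlgebra k n := gen k n (.path (.b i))

/-- The Euler continuant `(a₁, b₁, …, a_n, b_n)`. -/
def eulerAB : BoalchAlgebra k n := continuantAB (e k n 1) (a k n) (b k n)

/-- The Euler continuant `(b_n, a_n, …, b₁, a₁)`. -/
def eulerBA : BoalchAlgebra k n := continuantBA (e k n 0) (a k n) (b k n)

/-- The inverse `(a₁,…,b_n)⁻¹` at the vertex `2`. -/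
def eulerABInv : BoalchAlgebra k n := gen k n (.inv 1)

/-- The inverse `(b_n,…,a₁)⁻¹` at the vertex `1`. -/
def eulerBAInv : BoalchAlgebra k n := gen k n (.inv 0)

/-- The element `Φ = (a₁,…,b_n) + (b_n,…,a₁)⁻¹`. -/
def Phi : BoalchAlgebra k n := eulerAB k n + eulerBAInv k n

theorem mk_loopVar_zero :
    RingQuot.mkAlgHom k (BoalchRel k n) (loopVar k n 0) = eulerBA k n :=
  map_continuantBA (RingQuot.mkAlgHom k (BoalchRel k n)).toRingHom _ _ _

theorem mk_loopVar_one :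
    RingQuot.mkAlgHom k (BoalchRel k n) (loopVar k n 1) = eulerAB k n :=
  map_continuantAB (RingQuot.mkAlgHom k (BoalchRel k n)).toRingHom _ _ _

/-- The canonical morphism from the path algebra to the Boalch algebra. -/
def ofPath : PathAlgebra k n →ₐ[k] BoalchAlgebra k n :=
  RingQuot.liftAlgHom k ⟨(RingQuot.mkAlgHom k (BoalchRel k n)).comp
    (FreeAlgebra.lift k (pathVar k n)), by
      intro u v h
      rw [AlgHom.comp_apply, AlgHom.comp_apply]
      exact RingQuot.mkAlgHom_rel k (.path h)⟩

theorem ofPath_gen (x : PathGen n) : ofPath k n (PathAlgebra.gen k n x) = gen k n (.path x) := by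
  rw [ofPath, PathAlgebra.gen, RingQuot.liftAlgHom_mkAlgHom_apply]
  simp [gen, pathVar]

theorem eulerABInv_mul : eulerABInv k n * eulerAB k n = e k n 1 := by
  have h := RingQuot.mkAlgHom_rel k (BoalchRel.inv_loop (k := k) (n := n) 1)
  rw [map_mul, mk_loopVar_one] at h
  exact h

theorem eulerAB_mul_inv : eulerAB k n * eulerABInv k n = e k n 1 := by
  have h := RingQuot.mkAlgHom_rel k (BoalchRel.loop_inv (k := k) (n := n) 1)
  rw [map_mul, mk_loopVar_one] at h
  exact h

theorem eulerBAInv_mul : eulerBAInv k n * eulerBA k n = e k n 0 := by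
  have h := RingQuot.mkAlgHom_rel k (BoalchRel.inv_loop (k := k) (n := n) 0)
  rw [map_mul, mk_loopVar_zero] at h
  exact h

theorem eulerBA_mul_inv : eulerBA k n * eulerBAInv k n = e k n 0 := by
  have h := RingQuot.mkAlgHom_rel k (BoalchRel.loop_inv (k := k) (n := n) 0)
  rw [map_mul, mk_loopVar_zero] at h
  exact h

/-- The Boalch algebra is the universal algebra under the path algebra in which the two Euler
continuants have local inverses. -/
theorem existsUnique_lift {R : Type*} [Ring R] [Algebra k R] (f : PathAlgebra k n →ₐ[k] R)
    (x : Fin 2 → R)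
    (hl : ∀ s, f (PathAlgebra.gen k n (.e s)) * x s = x s)
    (hr : ∀ s, x s * f (PathAlgebra.gen k n (.e s)) = x s)
    (h1 : x 1 * f (PathAlgebra.eulerAB k n) = f (PathAlgebra.gen k n (.e 1)))
    (h1' : f (PathAlgebra.eulerAB k n) * x 1 = f (PathAlgebra.gen k n (.e 1)))
    (h0 : x 0 * f (PathAlgebra.eulerBA k n) = f (PathAlgebra.gen k n (.e 0)))
    (h0' : f (PathAlgebra.eulerBA k n) * x 0 = f (PathAlgebra.gen k n (.e 0))) :
    ∃! F : BoalchAlgebra k n →ₐ[k] R,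
      F.comp (ofPath k n) = f ∧ F (eulerABInv k n) = x 1 ∧ F (eulerBAInv k n) = x 0 := by
  let g : BoalchGen n → R := fun y => match y with
    | .path z => f (PathAlgebra.gen k n z)
    | .inv s => x s
  have gp (z) : FreeAlgebra.lift k g (pathVar k n z) = f (PathAlgebra.gen k n z) := by
    simp [pathVar, g]
  have gi (s) : FreeAlgebra.lift k g (invVar k n s) = x s := by simp [invVar, g]
  have gl0 : FreeAlgebra.lift k g (loopVar k n 0) = f (PathAlgebra.eulerBA k n) := by
    have e1 := map_continuantBA (FreeAlgebra.lift k g).toRingHom (pathVar k n (.e 0))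
      (fun i => pathVar k n (PathGen.a i)) (fun i => pathVar k n (PathGen.b i))
    have e2 := map_continuantBA f.toRingHom (PathAlgebra.gen k n (.e 0))
      (fun i => PathAlgebra.gen k n (.a i)) (fun i => PathAlgebra.gen k n (.b i))
    refine e1.trans (Eq.trans ?_ e2.symm)
    simp [gp]
  have gl1 : FreeAlgebra.lift k g (loopVar k n 1) = f (PathAlgebra.eulerAB k n) := by
    have e1 := map_continuantAB (FreeAlgebra.lift k g).toRingHom (pathVar k n (.e 1))
      (fun i => pathVar k n (PathGen.a i)) (fun i => pathVar k n (PathGen.b i))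
    have e2 := map_continuantAB f.toRingHom (PathAlgebra.gen k n (.e 1))
      (fun i => PathAlgebra.gen k n (.a i)) (fun i => PathAlgebra.gen k n (.b i))
    refine e1.trans (Eq.trans ?_ e2.symm)
    simp [gp]
  have gf : (FreeAlgebra.lift k g).comp (FreeAlgebra.lift k (pathVar k n)) =
      f.comp (RingQuot.mkAlgHom k (PathRel k n)) := by
    ext z
    simpa [PathAlgebra.gen] using gp z
  have hrel : ∀ ⦃u v⦄, BoalchRel k n u v →
      FreeAlgebra.lift k g u = FreeAlgebra.lift k g v := by
    intro u v h
    cases h with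
    | path h =>
      have hu := DFunLike.congr_fun gf
      simp only [AlgHom.comp_apply] at hu
      rw [hu, hu, RingQuot.mkAlgHom_rel k h]
    | e_inv s => rw [map_mul, gp, gi, hl]
    | inv_e s => rw [map_mul, gp, gi, hr]
    | inv_loop s =>
      fin_cases s
      · simp only [Fin.zero_eta]
        rw [map_mul, gp, gi, gl0, h0]
      · simp only [Fin.mk_one]
        rw [map_mul, gp, gi, gl1, h1]
    | loop_inv s =>
      fin_cases s
      · simp only [Fin.zero_eta]
        rw [map_mul, gp, gi, gl0, h0']
      · simp only [Fin.mk_one]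
        rw [map_mul, gp, gi, gl1, h1']
  refine ⟨RingQuot.liftAlgHom k ⟨FreeAlgebra.lift k g, hrel⟩, ⟨?_, ?_, ?_⟩, ?_⟩
  · ext z
    have h := ofPath_gen k n z
    simp only [PathAlgebra.gen] at h
    simp only [Function.comp_apply, AlgHom.coe_comp]
    rw [h, gen, RingQuot.liftAlgHom_mkAlgHom_apply]
    exact gp z
  · rw [eulerABInv, gen, RingQuot.liftAlgHom_mkAlgHom_apply]
    exact gi 1
  · rw [eulerBAInv, gen, RingQuot.liftAlgHom_mkAlgHom_apply]
    exact gi 0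
  · rintro F ⟨hF, hF1, hF0⟩
    ext z
    simp only [Function.comp_apply, AlgHom.coe_comp]
    rw [RingQuot.liftAlgHom_mkAlgHom_apply, FreeAlgebra.lift_ι_apply]
    cases z with
    | path z =>
      have h := DFunLike.congr_fun hF (PathAlgebra.gen k n z)
      rw [AlgHom.comp_apply, ofPath_gen] at h
      exact h
    | inv s =>
      fin_cases s
      · exact hF0
      · exact hF1

end BoalchAlgebra

/-! ### The double bracket -/

open BoalchAlgebra in
/-- The double bracket `D` on the Boalch algebra takes the prescribed values on the arrows. -/
structure IsEulerBracket (D : DoubleBracket k (e k n)) : Prop where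
  aa : ∀ i j : Fin n, D.br (a k n i) (a k n j) =
    if i < j then
      -((1 / 2 : k) • (a k n i ⊗ₜ[k] a k n j + a k n j ⊗ₜ[k] a k n i))
    else if i = j then 0
    else (1 / 2 : k) • (a k n i ⊗ₜ[k] a k n j + a k n j ⊗ₜ[k] a k n i)
  bb : ∀ i j : Fin n, D.br (b k n i) (b k n j) =
    if i < j then
      -((1 / 2 : k) • (b k n i ⊗ₜ[k] b k n j + b k n j ⊗ₜ[k] b k n i))
    else if i = j then 0
    else (1 / 2 : k) • (b k n i ⊗ₜ[k] b k n j + b k n j ⊗ₜ[k] b k n i)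
  ab : ∀ i j : Fin n, D.br (a k n i) (b k n j) =
    if i < j then
      (1 / 2 : k) • (e k n 0 ⊗ₜ[k] (a k n i * b k n j) + (b k n j * a k n i) ⊗ₜ[k] e k n 1)
    else if i = j then
      (1 / 2 : k) • ((b k n i * a k n i) ⊗ₜ[k] e k n 1 + e k n 0 ⊗ₜ[k] (a k n i * b k n i))
        + e k n 0 ⊗ₜ[k] e k n 1
    else
      -((1 / 2 : k) • ((b k n j * a k n i) ⊗ₜ[k] e k n 1 + e k n 0 ⊗ₜ[k] (a k n i * b k n j)))
        - (if (i : ℕ) = (j : ℕ) + 1 then e k n 0 ⊗ₜ[k] e k n 1 else 0)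
  ba : ∀ i j : Fin n, D.br (b k n i) (a k n j) =
    if i < j then
      (1 / 2 : k) • (e k n 1 ⊗ₜ[k] (b k n i * a k n j) + (a k n j * b k n i) ⊗ₜ[k] e k n 0)
        + (if (j : ℕ) = (i : ℕ) + 1 then e k n 1 ⊗ₜ[k] e k n 0 else 0)
    else if i = j then
      -((1 / 2 : k) • (e k n 1 ⊗ₜ[k] (b k n i * a k n i) + (a k n i * b k n i) ⊗ₜ[k] e k n 0))
        - e k n 1 ⊗ₜ[k] e k n 0
    else
      -((1 / 2 : k) • ((a k n j * b k n i) ⊗ₜ[k] e k n 0 + e k n 1 ⊗ₜ[k] (b k n i * a k n j)))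

end Algebras

end Boalch

end

/-!
# The double quasi-Poisson structure on the Boalch algebra

Every statement about brackets is reduced to the arrows by one principle: a derivation of the Boalch
algebra, for any bimodule structure `x · t · y = l x * t * r y` on an algebra `T`, is determined by
its values on the idempotents and the arrows (`IsDerivationAlong.ext_arrows`), since its values on
the local inverses follow from the Leibniz rule.  Conversely the values on arrows can be prescribed
(`exists_isDerivationAlong`), by lifting arrows to upper triangular `2 × 2` matrices over `T`; such
a matrix is invertible as soon as its diagonal is.

Uniqueness of the double bracket is immediate from this.  For existence, `{{x, -}}` is first
constructed for an arrow `x`, as a derivation for the outer bimodule structure on `A ⊗ A`, and then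
`{{-, y}}` for every `y`, as a derivation for the inner one (`exists_doubleBracket`); bilinearity,
the Leibniz rule and antisymmetry are again checked on arrows.

Both sides of the quasi-Poisson identity are derivations in the last argument and are compatible
with cyclic permutations, so the identity has to be checked on three arrows only.  For `a, a, a` and
`a, a, b` it comes down to identities between signs (`sgnDiff_mul_cyclic`, `sgnAB_mul_cyclic`,
`coeffAB_mul`).  The symmetry which exchanges the vertices and `a_i` with `b_{n+1-i}` turns the
double bracket into its opposite (`EulerSystem.swap`), which yields the other cases.

For the moment map, the brackets of all the continuants `(a₁, b₁, …, a_i)` and `(a₁, b₁, …, a_i,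
b_i)` with an arrow are computed by induction on `i`.  Their shape only depends on the position of
the arrow relative to the last letter of the word, apart from an extra term when the arrow is the
letter that follows.  For the full word and any arrow this gives the moment map identity at the
second vertex.  By the symmetry, `(b_n, a_n, …, b₁, a₁)` satisfies it for the opposite double
bracket, so that its local inverse satisfies it for the double bracket itself
(`momentMap_of_inverse`).
-/

open scoped TensorProduct

noncomputable section

namespace Boalch

/-! ### Derivations along a pair of morphisms -/

section Derivations

variable {k : Type*} [Field k] {A T : Type*} [Ring A] [Algebra k A] [Ring T] [Algebra k T]

/-- `d : A → T` is a `k`-linear derivation for the `A`-bimodule structure on `T` in which `x` acts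
on the left through `l x` and on the right through `r x`. -/
structure IsDerivationAlong (l r : A →ₐ[k] T) (d : A → T) : Prop where
  map_add : ∀ x y, d (x + y) = d x + d y
  map_smul : ∀ (c : k) x, d (c • x) = c • d x
  map_mul : ∀ x y, d (x * y) = l x * d y + d x * r y

namespace IsDerivationAlong

variable {l r : A →ₐ[k] T} {d d' : A → T}

theorem sub (h : IsDerivationAlong l r d) (h' : IsDerivationAlong l r d') :
    IsDerivationAlong l r (fun x => d x - d' x) where
  map_add x y := by rw [h.map_add, h'.map_add]; abel
  map_smul c x := by rw [h.map_smul, h'.map_smul, smul_sub]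
  map_mul x y := by rw [h.map_mul, h'.map_mul]; noncomm_ring

theorem add (h : IsDerivationAlong l r d) (h' : IsDerivationAlong l r d') :
    IsDerivationAlong l r (fun x => d x + d' x) where
  map_add x y := by rw [h.map_add, h'.map_add]; abel
  map_smul c x := by rw [h.map_smul, h'.map_smul, smul_add]
  map_mul x y := by rw [h.map_mul, h'.map_mul]; noncomm_ring

theorem const_smul (h : IsDerivationAlong l r d) (c : k) :
    IsDerivationAlong l r (fun x => c • d x) where
  map_add x y := by rw [h.map_add, smul_add]
  map_smul c' x := by rw [h.map_smul, smul_comm]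
  map_mul x y := by rw [h.map_mul, smul_add, mul_smul_comm, smul_mul_assoc]

/-- Multiplying a derivation by elements which commute with the two actions gives a derivation. -/
theorem mul_mul (h : IsDerivationAlong l r d) {u v : T} (hu : ∀ x, Commute u (l x))
    (hv : ∀ x, Commute v (r x)) : IsDerivationAlong l r (fun x => u * d x * v) where
  map_add x y := by rw [h.map_add, mul_add, add_mul]
  map_smul c x := by rw [h.map_smul, mul_smul_comm, smul_mul_assoc]
  map_mul x y := by
    rw [h.map_mul, mul_add, add_mul, ← mul_assoc u, (hu x).eq, mul_assoc, mul_assoc,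
      mul_assoc u (d x * r y), mul_assoc (d x), ← (hv y).eq]
    simp only [mul_assoc]

theorem inner (l r : A →ₐ[k] T) (m : T) :
    IsDerivationAlong l r (fun x => l x * m - m * r x) where
  map_add x y := by rw [_root_.map_add, _root_.map_add]; noncomm_ring
  map_smul c x := by
    rw [_root_.map_smul, _root_.map_smul, smul_mul_assoc, mul_smul_comm, smul_sub]
  map_mul x y := by rw [_root_.map_mul, _root_.map_mul]; noncomm_ring

theorem map_one (h : IsDerivationAlong l r d) : d 1 = 0 := by
  simpa using h.map_mul 1 1

end IsDerivationAlong

end Derivations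

/-! ### The derivation properties of double and triple brackets -/

section Brackets

variable {k : Type*} [Field k] {A : Type*} [Ring A] [Algebra k A]

open Algebra.TensorProduct

namespace DoubleBracket

variable {I : Type*} {e : I → A} (D : DoubleBracket k e)

theorem comm_mul (x y : A ⊗[k] A) : TensorProduct.comm k A A (x * y) =
    TensorProduct.comm k A A x * TensorProduct.comm k A A y :=
  map_mul (Algebra.TensorProduct.comm k A A) x y

theorem comm_comm (x : A ⊗[k] A) :
    TensorProduct.comm k A A (TensorProduct.comm k A A x) = x :=
  (TensorProduct.comm k A A).symm_apply_apply x

theorem isDerivationAlong_br (a : A) :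
    IsDerivationAlong (includeLeft : A →ₐ[k] A ⊗[k] A) includeRight (D.br a) where
  map_add := map_add _
  map_smul := map_smul _
  map_mul x y := by rw [D.leibniz, add_comm]; rfl

/-- The Leibniz rule in the first argument, for the inner bimodule structure on `A ⊗ A`. -/
theorem br_mul_left (a b c : A) :
    D.br (a * b) c = (1 ⊗ₜ a) * D.br b c + D.br a c * (b ⊗ₜ 1) := by
  rw [D.cyclic_antisymm, D.leibniz, map_add, comm_mul, comm_mul, D.cyclic_antisymm b c,
    D.cyclic_antisymm a c]
  simp [add_comm]

theorem isDerivationAlong_br_left (c : A) :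
    IsDerivationAlong (includeRight : A →ₐ[k] A ⊗[k] A) includeLeft (fun a => D.br a c) where
  map_add x y := by simp
  map_smul x y := by simp
  map_mul x y := D.br_mul_left x y c

theorem br_e (a : A) (s : I) : D.br a (e s) = 0 :=
  D.map_base a _ (Submodule.subset_span ⟨s, rfl⟩)

theorem br_e_left (s : I) (a : A) : D.br (e s) a = 0 := by
  rw [D.cyclic_antisymm, br_e, map_zero, neg_zero]

/-- The opposite double bracket. -/
def neg : DoubleBracket k e where
  br := -D.br
  cyclic_antisymm a b := by
    rw [LinearMap.neg_apply, LinearMap.neg_apply, LinearMap.neg_apply, LinearMap.neg_apply,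
      D.cyclic_antisymm, map_neg]
  leibniz a b c := by
    simp only [LinearMap.neg_apply, D.leibniz]
    noncomm_ring
  map_base a b hb := by
    rw [LinearMap.neg_apply, LinearMap.neg_apply, D.map_base a b hb, neg_zero]

/-- A double bracket, linear over the same base with reindexed idempotents. -/
def reindex {J : Type*} (f : J ≃ I) : DoubleBracket k (e ∘ f) where
  br := D.br
  cyclic_antisymm := D.cyclic_antisymm
  leibniz := D.leibniz
  map_base a b hb := D.map_base a b (by rwa [f.surjective.range_comp] at hb)

theorem triple_cyclic (a b c : A) : D.triple a b c = tau123 k (D.triple b c a) := by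
  have h1 : ∀ x : A ⊗[k] A ⊗[k] A, tau123 k (tau132 k x) = x := fun x => by
    simp [tau123, tau132]
  have h2 : ∀ x : A ⊗[k] A ⊗[k] A, tau123 k (tau123 k x) = tau132 k x := fun x => by
    induction x with
    | zero => simp
    | add x y hx hy => simp [hx, hy]
    | tmul x z =>
      induction x with
      | zero => simp
      | add x y hx hy => rw [TensorProduct.add_tmul]; simp only [map_add, hx, hy]
      | tmul x y => simp [tau123_tmul, tau132_tmul]
  simp only [triple, map_add, h1, h2]
  abel

theorem brL_mul_right (a c : A) (m : A ⊗[k] A) :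
    D.brL a (m * (1 ⊗ₜ c)) = D.brL a m * (1 ⊗ₜ c) := by
  induction m with
  | zero => simp
  | add x y hx hy => simp [add_mul, hx, hy]
  | tmul x y => simp [brL_tmul]

theorem brL_mul_left_right (a c : A) (m : A ⊗[k] A) :
    D.brL a ((1 ⊗ₜ c) * m) = (1 ⊗ₜ c) * D.brL a m := by
  induction m with
  | zero => simp
  | add x y hx hy => simp [mul_add, hx, hy]
  | tmul x y => simp [brL_tmul]

theorem brL_mul_left (a c : A) (m : A ⊗[k] A) :
    D.brL a ((c ⊗ₜ 1) * m) = ((c ⊗ₜ 1) ⊗ₜ 1) * D.brL a m +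
      (D.br a c ⊗ₜ 1) * (TensorProduct.assoc k A A A).symm (1 ⊗ₜ m) := by
  induction m with
  | zero => simp
  | add x y hx hy =>
    rw [mul_add, map_add, hx, hy, TensorProduct.tmul_add, map_add, map_add, mul_add, mul_add]
    abel
  | tmul x y =>
    simp only [tmul_mul_tmul, one_mul, brL_tmul, D.leibniz, TensorProduct.assoc_symm_tmul,
      TensorProduct.add_tmul]
    abel

/-- The terms of the two Leibniz rules in `triple` which are not of Leibniz form are the product
`(u ⊗ v, p ⊗ q) ↦ u ⊗ v p ⊗ q` of two double brackets; see also `brL_mul_left`. -/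
theorem tau123_brL_mul_right_left (a c : A) (m : A ⊗[k] A) :
    tau123 k (D.brL a (m * (c ⊗ₜ 1))) = tau123 k (D.brL a m) * (1 ⊗ₜ c) +
      (TensorProduct.comm k A A m ⊗ₜ 1) * (TensorProduct.assoc k A A A).symm (1 ⊗ₜ D.br a c) := by
  induction m with
  | zero => simp
  | add x y hx hy =>
    rw [add_mul, map_add, map_add, hx, hy, map_add, map_add, map_add, TensorProduct.add_tmul,
      add_mul, add_mul]
    abel
  | tmul x y =>
    have h1 : ∀ p : A ⊗[k] A, tau123 k ((p * (1 ⊗ₜ c)) ⊗ₜ y) = tau123 k (p ⊗ₜ y) * (1 ⊗ₜ c) :=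
      fun p => by
        induction p with
        | zero => simp
        | add p q hp hq =>
          rw [add_mul, TensorProduct.add_tmul, map_add, hp, hq, TensorProduct.add_tmul, map_add,
            add_mul]
        | tmul p q => simp [tau123_tmul, one_def]
    have h2 : ∀ p : A ⊗[k] A, tau123 k (((x ⊗ₜ 1) * p) ⊗ₜ y) =
        ((y ⊗ₜ x) ⊗ₜ 1) * (TensorProduct.assoc k A A A).symm (1 ⊗ₜ p) := fun p => by
      induction p with
      | zero => simp
      | add p q hp hq =>
        rw [mul_add, TensorProduct.add_tmul, map_add, hp, hq, TensorProduct.tmul_add, map_add,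
          mul_add]
      | tmul p q => simp [tau123_tmul]
    rw [tmul_mul_tmul, mul_one, brL_tmul, D.leibniz, TensorProduct.add_tmul, map_add, h1, h2,
      brL_tmul, TensorProduct.comm_tmul]

theorem brL_mul (c d : A) (m : A ⊗[k] A) : D.brL (c * d) m =
    ((1 ⊗ₜ c) ⊗ₜ 1) * D.brL d m + D.brL c m * ((d ⊗ₜ 1) ⊗ₜ 1) := by
  induction m with
  | zero => simp
  | add x y hx hy =>
    rw [map_add, hx, hy, map_add, map_add]
    noncomm_ring
  | tmul x y => simp [brL_tmul, br_mul_left, TensorProduct.add_tmul]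

end DoubleBracket

theorem tau123_mul (x y : A ⊗[k] A ⊗[k] A) : tau123 k (x * y) = tau123 k x * tau123 k y :=
  map_mul ((Algebra.TensorProduct.comm k (A ⊗[k] A) A).trans
    (Algebra.TensorProduct.assoc k k k A A A).symm) x y

theorem tau132_mul (x y : A ⊗[k] A ⊗[k] A) : tau132 k (x * y) = tau132 k x * tau132 k y :=
  map_mul ((Algebra.TensorProduct.assoc k k k A A A).trans
    (Algebra.TensorProduct.comm k A (A ⊗[k] A))) x y

/-- Left multiplication on the first factor of `A ⊗ A ⊗ A`. -/
def left3 (k : Type*) [Field k] (A : Type*) [Ring A] [Algebra k A] : A →ₐ[k] A ⊗[k] A ⊗[k] A :=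
  includeLeft.comp includeLeft

/-- Right multiplication on the last factor of `A ⊗ A ⊗ A`. -/
def right3 (k : Type*) [Field k] (A : Type*) [Ring A] [Algebra k A] : A →ₐ[k] A ⊗[k] A ⊗[k] A :=
  includeRight

theorem left3_apply (a : A) : left3 k A a = a ⊗ₜ 1 ⊗ₜ 1 := rfl

theorem right3_apply (a : A) : right3 k A a = 1 ⊗ₜ 1 ⊗ₜ a := rfl

/-- The triple bracket is a derivation in its last argument: the two terms which violate the
Leibniz rule cancel by cyclic antisymmetry. -/
theorem DoubleBracket.isDerivationAlong_triple {I : Type*} {e : I → A} (D : DoubleBracket k e)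
    (a b : A) : IsDerivationAlong (left3 k A) (right3 k A) (D.triple a b) where
  map_add x y := by
    simp only [triple, map_add, LinearMap.add_apply, brL, LinearMap.rTensor_add]
    abel
  map_smul c x := by
    simp only [triple, map_smul, LinearMap.smul_apply, brL, LinearMap.rTensor_smul, smul_add]
  map_mul x y := by
    have h : TensorProduct.comm k A A (D.br x a) ⊗ₜ 1 *
          (TensorProduct.assoc k A A A).symm (1 ⊗ₜ D.br b y) +
        D.br a x ⊗ₜ 1 * (TensorProduct.assoc k A A A).symm (1 ⊗ₜ D.br b y) = 0 := by
      rw [← add_mul, ← TensorProduct.add_tmul, D.cyclic_antisymm a x, add_neg_cancel,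
        TensorProduct.zero_tmul, zero_mul]
    simp only [triple]
    rw [D.leibniz, map_add, D.brL_mul_right, D.brL_mul_left, D.br_mul_left, map_add, map_add,
      D.brL_mul_left_right, D.tau123_brL_mul_right_left, tau123_mul, D.brL_mul, map_add,
      tau132_mul, tau132_mul, one_def, tau123_tmul,
      tau132_tmul, tau132_tmul, left3_apply, right3_apply]
    linear_combination (norm := noncomm_ring) h

theorem DoubleBracket.triple_e {I : Type*} {e : I → A} (D : DoubleBracket k e) (a b : A) (t : I) :
    D.triple a b (e t) = 0 := by
  have h : D.brL (e t) = 0 := by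
    rw [brL, show D.br (e t) = 0 from LinearMap.ext (D.br_e_left t), LinearMap.rTensor_zero]
  rw [triple, D.br_e, D.br_e_left, h]
  simp

section QuasiPoisson

variable {I : Type*} [Fintype I] {e : I → A}

theorem tripleQP_cyclic (a b c : A) :
    tripleQP k e a b c = tau123 k (tripleQP k e b c a) := by
  simp only [tripleQP, map_smul, map_sum, map_add, map_sub, tau123_tmul]
  congr 1
  refine Finset.sum_congr rfl fun s _ => ?_
  abel

/-- The right side of the quasi-Poisson property is an inner derivation in its last argument. -/
theorem isDerivationAlong_tripleQP (a b : A) :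
    IsDerivationAlong (left3 k A) (right3 k A) (tripleQP k e a b) := by
  convert (IsDerivationAlong.inner (left3 k A) (right3 k A)
    (∑ s, ((e s * a) ⊗ₜ[k] (e s * b) ⊗ₜ[k] e s - (e s * a) ⊗ₜ[k] e s ⊗ₜ[k] (b * e s)
      - e s ⊗ₜ[k] (a * e s * b) ⊗ₜ[k] e s + e s ⊗ₜ[k] (a * e s) ⊗ₜ[k] (b * e s)))).const_smul
    (1 / 4 : k) using 2 with c
  rw [tripleQP, Finset.mul_sum, Finset.sum_mul, ← Finset.sum_sub_distrib]
  congr 1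
  refine Finset.sum_congr rfl fun s _ => ?_
  simp only [left3_apply, right3_apply, mul_add, mul_sub, add_mul, sub_mul, tmul_mul_tmul, one_mul,
    mul_one, mul_assoc]
  abel

theorem tripleQP_e (he : OrthogonalIdempotents e) (a b : A) (t : I) :
    tripleQP k e a b (e t) = 0 := by
  classical
  rw [tripleQP, Finset.sum_eq_single t]
  · simp only [mul_assoc, he.idem t |>.eq]
    rw [smul_eq_zero]
    right
    abel
  · intro s _ hs
    simp only [mul_assoc, he.ortho hs, he.ortho hs.symm]
    simp
  · simp

end QuasiPoisson

end Brackets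

/-! ### Brackets of Euler type on the generators -/

section System

variable {k : Type*} [Field k] {A : Type*} [Ring A] [Algebra k A] {e : Fin 2 → A}

/-- The sign of `i - j`, with values in `k`. -/
def sgnDiff (k : Type*) [Field k] (i j : ℕ) : k := if i < j then -1 else if i = j then 0 else 1

/-- The sign of `2 (j - i) + 1`, with values in `k`: in the order `a₁, b₁, a₂, b₂, …` of the arrows
it is `1` if `a_i` comes before `b_j` and `-1` otherwise. -/
def sgnAB (k : Type*) [Field k] (i j : ℕ) : k := if i ≤ j then 1 else -1

/-- The coefficient of `e₁ ⊗ e₂` in the bracket of `a_i` and `b_j`; it is nonzero for neighbours in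
the order `a₁, b₁, a₂, b₂, …` of the arrows. -/
def coeffAB (k : Type*) [Field k] (i j : ℕ) : k := if i = j then 1 else if i = j + 1 then -1 else 0

theorem sgnDiff_self (i : ℕ) : sgnDiff k i i = 0 := by simp [sgnDiff]

theorem sgnDiff_symm (i j : ℕ) : sgnDiff k i j = -sgnDiff k j i := by
  unfold sgnDiff
  split_ifs <;> first | omega | simp

/-- Up to a factor `1 / 4`, this is the coefficient of `a_i ⊗ a_j ⊗ a_l` in the triple bracket of
`a_i, a_j, a_l`.  For equal indices the left side is `0`, and both triple brackets vanish. -/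
theorem sgnDiff_mul_cyclic {i j l : ℕ} (hne : ¬ (i = j ∧ j = l)) : sgnDiff k i j * sgnDiff k j l -
    sgnDiff k i j * sgnDiff k i l - sgnDiff k j l * sgnDiff k i l = -1 := by
  unfold sgnDiff
  split_ifs <;> first | omega | norm_num

/-- Up to a factor `1 / 4`, this is the coefficient of `b_l a_i ⊗ a_j ⊗ e₂` in the triple bracket of
`a_i, a_j, b_l`. -/
theorem sgnAB_mul_cyclic (i j l : ℕ) : sgnAB k i l * sgnAB k j l +
    sgnDiff k i j * sgnAB k j l - sgnDiff k i j * sgnAB k i l = 1 := by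
  unfold sgnDiff sgnAB
  split_ifs <;> first | omega | norm_num

/-- The constant terms `e₁ ⊗ e₂` of the brackets do not contribute to the triple bracket of
`a_i, a_j, b_l` if `i ≠ j`; for `i = j` their two contributions cancel each other. -/
theorem coeffAB_mul {i j l : ℕ} (hij : i ≠ j) :
    coeffAB k i l * (sgnAB k j l - sgnDiff k i j) = 0 := by
  unfold sgnDiff sgnAB coeffAB
  split_ifs <;> first | omega | norm_num

/-- The elements `a i : 1 → 2` and `b i : 2 → 1` of `A`, for `i < n`, have the double brackets
prescribed on the arrows of the quiver.  Indices are natural numbers so that continuants can be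
treated by recursion; elements with index at least `n` need not satisfy the bracket relations. -/
structure EulerSystem (D : DoubleBracket k e) (n : ℕ) (a b : ℕ → A) : Prop where
  idem : CompleteOrthogonalIdempotents e
  e_a : ∀ i, e 1 * a i = a i
  a_e : ∀ i, a i * e 0 = a i
  e_b : ∀ i, e 0 * b i = b i
  b_e : ∀ i, b i * e 1 = b i
  br_aa : ∀ i < n, ∀ j < n, D.br (a i) (a j) =
    (1 / 2 * sgnDiff k i j) • (a i ⊗ₜ[k] a j + a j ⊗ₜ[k] a i)
  br_bb : ∀ i < n, ∀ j < n, D.br (b i) (b j) =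
    (1 / 2 * sgnDiff k i j) • (b i ⊗ₜ[k] b j + b j ⊗ₜ[k] b i)
  br_ab : ∀ i < n, ∀ j < n, D.br (a i) (b j) =
    (1 / 2 * sgnAB k i j) • (e 0 ⊗ₜ[k] (a i * b j) + (b j * a i) ⊗ₜ[k] e 1)
      + coeffAB k i j • (e 0 ⊗ₜ[k] e 1)

theorem DoubleBracket.triple_neg_reindex (D : DoubleBracket k e) (x y z : A) :
    (D.neg.reindex Fin.revPerm).triple x y z = D.triple x y z := by
  have hb : ∀ x m, (D.neg.reindex Fin.revPerm).brL x m = -D.brL x m := fun x m => by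
    change LinearMap.rTensor A (-D.br x) m = -LinearMap.rTensor A (D.br x) m
    rw [LinearMap.rTensor_neg, LinearMap.neg_apply]
  have hn : ∀ x y, (D.neg.reindex Fin.revPerm).br x y = -D.br x y := fun _ _ => rfl
  simp only [DoubleBracket.triple, hb, hn, map_neg, neg_neg]

theorem tripleQP_reindex (x y z : A) :
    tripleQP k (e ∘ Fin.revPerm) x y z = tripleQP k e x y z := by
  rw [tripleQP, tripleQP]
  congr 1
  exact Equiv.sum_comp Fin.revPerm (fun s =>
    ((z * e s * x) ⊗ₜ[k] (e s * y) ⊗ₜ[k] e s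
      - (z * e s * x) ⊗ₜ[k] e s ⊗ₜ[k] (y * e s)
      - (z * e s) ⊗ₜ[k] (x * e s * y) ⊗ₜ[k] e s
      + (z * e s) ⊗ₜ[k] (x * e s) ⊗ₜ[k] (y * e s)
      - (e s * x) ⊗ₜ[k] (e s * y) ⊗ₜ[k] (e s * z)
      + (e s * x) ⊗ₜ[k] e s ⊗ₜ[k] (y * e s * z)
      + e s ⊗ₜ[k] (x * e s * y) ⊗ₜ[k] (e s * z)
      - e s ⊗ₜ[k] (x * e s) ⊗ₜ[k] (y * e s * z)))

theorem triple_eq_tripleQP_cyclic {D : DoubleBracket k e} {x y z : A}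
    (h : D.triple x y z = tripleQP k e x y z) : D.triple z x y = tripleQP k e z x y := by
  rw [D.triple_cyclic, tripleQP_cyclic, h]

namespace EulerSystem

variable {D : DoubleBracket k e} {n : ℕ} {a b : ℕ → A}

section Relations

variable (h : EulerSystem D n a b)
include h

theorem ee_zero_one : e 0 * e 1 = 0 := h.idem.ortho (by decide)

theorem ee_one_zero : e 1 * e 0 = 0 := h.idem.ortho (by decide)

theorem e_a_zero (i : ℕ) : e 0 * a i = 0 := by
  rw [← h.e_a, ← mul_assoc, h.ee_zero_one, zero_mul]

theorem a_e_zero (i : ℕ) : a i * e 1 = 0 := by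
  rw [← h.a_e, mul_assoc, h.ee_zero_one, mul_zero]

theorem e_b_zero (i : ℕ) : e 1 * b i = 0 := by
  rw [← h.e_b, ← mul_assoc, h.ee_one_zero, zero_mul]

theorem b_e_zero (i : ℕ) : b i * e 0 = 0 := by
  rw [← h.b_e, mul_assoc, h.ee_one_zero, mul_zero]

theorem a_a (i j : ℕ) : a i * a j = 0 := by
  rw [← h.a_e, mul_assoc, h.e_a_zero, mul_zero]

theorem br_ba {i j : ℕ} (hi : i < n) (hj : j < n) : D.br (b i) (a j) =
    (-(1 / 2) * sgnAB k j i) • (e 1 ⊗ₜ[k] (b i * a j) + (a j * b i) ⊗ₜ[k] e 0)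
      + (-coeffAB k j i) • (e 1 ⊗ₜ[k] e 0) := by
  rw [D.cyclic_antisymm, h.br_ab j hj i hi]
  simp only [map_add, map_smul, TensorProduct.comm_tmul]
  module

end Relations

theorem triple_aaa [CharZero k] (h : EulerSystem D n a b) {i j l : ℕ} (hi : i < n) (hj : j < n)
    (hl : l < n) : D.triple (a i) (a j) (a l) = tripleQP k e (a i) (a j) (a l) := by
  simp only [DoubleBracket.triple, tripleQP, h.br_aa _ hi _ hj, h.br_aa _ hi _ hl,
    h.br_aa _ hj _ hl, h.br_aa _ hj _ hi, h.br_aa _ hl _ hi, h.br_aa _ hl _ hj,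
    map_smul, map_add, D.brL_tmul, TensorProduct.add_tmul, ← TensorProduct.smul_tmul',
    tau123_tmul, tau132_tmul, Fin.sum_univ_two, h.e_a, h.a_e, h.e_a_zero, h.a_e_zero, h.a_a, zero_mul,
    TensorProduct.tmul_zero, TensorProduct.zero_tmul, sgnDiff_symm l i, sgnDiff_symm l j,
    sgnDiff_symm j i]
  by_cases hne : i = j ∧ j = l
  · obtain ⟨rfl, rfl⟩ := hne
    simp only [sgnDiff_self]
    module
  · have := sgnDiff_mul_cyclic (k := k) hne
    match_scalars
    all_goals first
      | ring1
      | linear_combination (1 / 4) * this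
      | linear_combination -(1 / 4) * this

theorem triple_aab [CharZero k] (h : EulerSystem D n a b) {i j l : ℕ} (hi : i < n) (hj : j < n)
    (hl : l < n) : D.triple (a i) (a j) (b l) = tripleQP k e (a i) (a j) (b l) := by
  simp only [DoubleBracket.triple, tripleQP, h.br_aa _ hi _ hj, h.br_aa _ hj _ hi,
    h.br_ab _ hi _ hl, h.br_ab _ hj _ hl, h.br_ba hl hi, h.br_ba hl hj,
    map_smul, map_add, D.brL_tmul, D.leibniz, D.br_e, add_mul, mul_add, smul_mul_assoc,
    mul_smul_comm, Algebra.TensorProduct.tmul_mul_tmul, one_mul, mul_one, TensorProduct.add_tmul,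
    ← TensorProduct.smul_tmul', tau123_tmul, tau132_tmul, Fin.sum_univ_two, h.e_a, h.a_e,
    h.e_a_zero, h.a_e_zero, h.a_a, h.e_b, h.b_e, h.e_b_zero, h.b_e_zero, mul_zero, map_zero,
    zero_add, add_zero, mul_assoc, TensorProduct.tmul_zero, TensorProduct.zero_tmul,
    sgnDiff_symm j i]
  have h0 := sgnAB_mul_cyclic (k := k) i j l
  by_cases hij : i = j
  · subst hij
    simp only [sgnDiff_self] at h0 ⊢
    match_scalars
    all_goals first
      | ring1
      | linear_combination (1 / 4) * h0
      | linear_combination -(1 / 4) * h0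
  · have h1 := coeffAB_mul (k := k) (l := l) hij
    have h2 := coeffAB_mul (k := k) (l := l) (Ne.symm hij)
    rw [sgnDiff_symm] at h2
    match_scalars
    all_goals first
      | ring1
      | linear_combination (1 / 4) * h0
      | linear_combination -(1 / 4) * h0
      | linear_combination (1 / 2) * h1
      | linear_combination -(1 / 2) * h2

/-- The symmetry of the quiver which exchanges the two vertices, `a_i` with `b_{n+1-i}`, and the
double bracket with its opposite. -/
theorem swap (h : EulerSystem D n a b) : EulerSystem (D.neg.reindex Fin.revPerm) n
    (fun i => b (n - 1 - i)) (fun i => a (n - 1 - i)) where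
  idem := (CompleteOrthogonalIdempotents.equiv Fin.revPerm).2 h.idem
  e_a _ := h.e_b _
  a_e _ := h.b_e _
  e_b _ := h.e_a _
  b_e _ := h.a_e _
  br_aa i hi j hj := by
    have hs : sgnDiff k (n - 1 - i) (n - 1 - j) = -sgnDiff k i j := by
      unfold sgnDiff
      split_ifs <;> first | omega | simp
    change -D.br _ _ = _
    rw [h.br_bb _ (by omega) _ (by omega), hs]
    module
  br_bb i hi j hj := by
    have hs : sgnDiff k (n - 1 - i) (n - 1 - j) = -sgnDiff k i j := by
      unfold sgnDiff
      split_ifs <;> first | omega | simp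
    change -D.br _ _ = _
    rw [h.br_aa _ (by omega) _ (by omega), hs]
    module
  br_ab i hi j hj := by
    have hs : sgnAB k (n - 1 - j) (n - 1 - i) = sgnAB k i j := by
      unfold sgnAB
      split_ifs <;> first | omega | simp
    have hc : coeffAB k (n - 1 - j) (n - 1 - i) = coeffAB k i j := by
      unfold coeffAB
      split_ifs <;> first | omega | simp
    change -D.br _ _ = _
    rw [h.br_ba (by omega) (by omega), hs, hc]
    change _ = (1 / 2 * sgnAB k i j) • (e 1 ⊗ₜ[k] _ + _ ⊗ₜ[k] e 0) + _ • (e 1 ⊗ₜ[k] e 0)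
    module

/-- The quasi-Poisson property on triples of arrows. -/
theorem triple_generators [CharZero k] (h : EulerSystem D n a b) {x y z : A}
    (hx : (∃ i < n, x = a i) ∨ ∃ i < n, x = b i) (hy : (∃ i < n, y = a i) ∨ ∃ i < n, y = b i)
    (hz : (∃ i < n, z = a i) ∨ ∃ i < n, z = b i) :
    D.triple x y z = tripleQP k e x y z := by
  -- The symmetry `swap` gives the cases with more `b`s than `a`s.
  have hrev : ∀ i < n, n - 1 - (n - 1 - i) = i := fun i hi => by omega
  have bbb : ∀ i < n, ∀ j < n, ∀ l < n,
      D.triple (b i) (b j) (b l) = tripleQP k e (b i) (b j) (b l) := fun i hi j hj l hl => by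
    have := h.swap.triple_aaa (i := n - 1 - i) (j := n - 1 - j) (l := n - 1 - l) (by omega)
      (by omega) (by omega)
    simpa only [hrev _ hi, hrev _ hj, hrev _ hl, D.triple_neg_reindex, tripleQP_reindex] using this
  have bba : ∀ i < n, ∀ j < n, ∀ l < n,
      D.triple (b i) (b j) (a l) = tripleQP k e (b i) (b j) (a l) := fun i hi j hj l hl => by
    have := h.swap.triple_aab (i := n - 1 - i) (j := n - 1 - j) (l := n - 1 - l) (by omega)
      (by omega) (by omega)
    simpa only [hrev _ hi, hrev _ hj, hrev _ hl, D.triple_neg_reindex, tripleQP_reindex] using this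
  obtain ⟨i, hi, rfl⟩ | ⟨i, hi, rfl⟩ := hx <;> obtain ⟨j, hj, rfl⟩ | ⟨j, hj, rfl⟩ := hy <;>
    obtain ⟨l, hl, rfl⟩ | ⟨l, hl, rfl⟩ := hz
  · exact h.triple_aaa hi hj hl
  · exact h.triple_aab hi hj hl
  · exact triple_eq_tripleQP_cyclic (triple_eq_tripleQP_cyclic (h.triple_aab hl hi hj))
  · exact triple_eq_tripleQP_cyclic (bba _ hj _ hl _ hi)
  · exact triple_eq_tripleQP_cyclic (h.triple_aab hj hl hi)
  · exact triple_eq_tripleQP_cyclic (triple_eq_tripleQP_cyclic (bba _ hl _ hi _ hj))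
  · exact bba _ hi _ hj _ hl
  · exact bbb _ hi _ hj _ hl

end EulerSystem
end System

/-! ### Brackets of Euler continuants -/

section Recursion

variable {R : Type*} [Ring R]

/-- The pair of consecutive continuants `(a₁, b₁, …, a_i, b_i)` and `(a₁, b₁, …, a_i)`; for `i = 0`
these are `u` and `0`, which is compatible with the recursion for continuants. -/
def eulerPair (u : R) (a b : ℕ → R) : ℕ → R × R
  | 0 => (u, 0)
  | i + 1 =>
    (((eulerPair u a b i).1 * a i + (eulerPair u a b i).2) * b i + (eulerPair u a b i).1,
      (eulerPair u a b i).1 * a i + (eulerPair u a b i).2)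

/-- The continuant `(a₁, b₁, …, a_i, b_i)`, where `a_j` and `b_j` are `a (j - 1)` and `b (j - 1)`.
-/
def evenCont (u : R) (a b : ℕ → R) (i : ℕ) : R := (eulerPair u a b i).1

/-- The continuant `(a₁, b₁, …, b_{i-1}, a_i)`, and `0` for `i = 0`. -/
def oddCont (u : R) (a b : ℕ → R) (i : ℕ) : R := (eulerPair u a b i).2

theorem evenCont_zero (u : R) (a b : ℕ → R) : evenCont u a b 0 = u := rfl

theorem oddCont_zero (u : R) (a b : ℕ → R) : oddCont u a b 0 = 0 := rfl

theorem evenCont_succ (u : R) (a b : ℕ → R) (i : ℕ) :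
    evenCont u a b (i + 1) = oddCont u a b (i + 1) * b i + evenCont u a b i := rfl

theorem oddCont_succ (u : R) (a b : ℕ → R) (i : ℕ) :
    oddCont u a b (i + 1) = evenCont u a b i * a i + oddCont u a b i := rfl

/-- Continuants of the reversed words `a₁, b₁, …, a_i, b_i` and `a₁, b₁, …, a_i, b_i, a_{i+1}`. -/
theorem continuantRev_eq_evenCont (u : R) (a b : ℕ → R) (hu : ∀ i, u * a i = a i) (i : ℕ) :
    continuantRev u ((List.range i).flatMap fun j => [a j, b j]).reverse = evenCont u a b i ∧
    continuantRev u (a i :: ((List.range i).flatMap fun j => [a j, b j]).reverse) =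
      oddCont u a b (i + 1) := by
  induction i with
  | zero => simp [continuantRev, evenCont_zero, oddCont_zero, oddCont_succ, hu]
  | succ i ih =>
    have key : ((List.range (i + 1)).flatMap fun j => [a j, b j]).reverse =
        b i :: a i :: ((List.range i).flatMap fun j => [a j, b j]).reverse := by
      simp [List.range_succ]
    have h1 : continuantRev u ((List.range (i + 1)).flatMap fun j => [a j, b j]).reverse =
        evenCont u a b (i + 1) := by
      rw [key, continuantRev, ih.1, ih.2, evenCont_succ]
    refine ⟨h1, ?_⟩
    rw [key, continuantRev, ← key, h1, ih.2, ← oddCont_succ]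

theorem evenCont_mul_right {u : R} {a b : ℕ → R} (huu : u * u = u) (hb : ∀ i, b i * u = b i)
    (i : ℕ) : evenCont u a b i * u = evenCont u a b i := by
  induction i with
  | zero => rw [evenCont_zero, huu]
  | succ i ih => rw [evenCont_succ, add_mul, mul_assoc, hb, ih]

theorem evenCont_mul_left {u : R} {a b : ℕ → R} (huu : u * u = u) (i : ℕ) :
    u * evenCont u a b i = evenCont u a b i := by
  suffices u * evenCont u a b i = evenCont u a b i ∧ u * oddCont u a b i = oddCont u a b i from
    this.1
  induction i with
  | zero => rw [evenCont_zero, oddCont_zero, huu, mul_zero]; exact ⟨rfl, rfl⟩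
  | succ i ih =>
    have h : u * oddCont u a b (i + 1) = oddCont u a b (i + 1) := by
      rw [oddCont_succ, mul_add, ← mul_assoc, ih.1, ih.2]
    exact ⟨by rw [evenCont_succ, mul_add, ← mul_assoc, h, ih.1], h⟩

theorem continuantAB_eq_evenCont {n : ℕ} (u : R) (a b : ℕ → R) (hu : ∀ i, u * a i = a i) :
    continuantAB u (fun i : Fin n => a i) (fun i : Fin n => b i) = evenCont u a b n := by
  rw [← (continuantRev_eq_evenCont u a b hu n).1, continuantAB, continuant]
  congr 2
  rw [← List.map_coe_finRange_eq_range, List.flatMap_map]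

/-- The extension by zero of a finite sequence. -/
def extendZero {n : ℕ} (a : Fin n → R) (i : ℕ) : R := if h : i < n then a ⟨i, h⟩ else 0

theorem extendZero_of_lt {n : ℕ} (a : Fin n → R) {i : ℕ} (h : i < n) :
    extendZero a i = a ⟨i, h⟩ := dif_pos h

theorem extendZero_coe {n : ℕ} (a : Fin n → R) (i : Fin n) : extendZero a i = a i :=
  dif_pos i.2

theorem mul_extendZero {n : ℕ} {a : Fin n → R} {u : R} (h : ∀ i, u * a i = a i) (i : ℕ) :
    u * extendZero a i = extendZero a i := by
  unfold extendZero
  split_ifs <;> simp [h]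

theorem extendZero_mul {n : ℕ} {a : Fin n → R} {u : R} (h : ∀ i, a i * u = a i) (i : ℕ) :
    extendZero a i * u = extendZero a i := by
  unfold extendZero
  split_ifs <;> simp [h]

theorem continuantAB_eq_evenCont_extendZero {n : ℕ} {u : R} {a : Fin n → R} (b : Fin n → R)
    (hu : ∀ i, u * a i = a i) :
    continuantAB u a b = evenCont u (extendZero a) (extendZero b) n := by
  rw [← continuantAB_eq_evenCont _ _ _ (mul_extendZero hu)]
  simp only [extendZero_coe]

theorem continuantBA_eq_continuantAB {n : ℕ} (u : R) (a b : Fin n → R) :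
    continuantBA u a b = continuantAB u (fun i => b i.rev) (fun i => a i.rev) := by
  rw [continuantBA, continuantAB, List.finRange_reverse, List.flatMap_map]

theorem mul_continuantAB {n : ℕ} {u : R} {a : Fin n → R} (b : Fin n → R) (huu : u * u = u)
    (hu : ∀ i, u * a i = a i) : u * continuantAB u a b = continuantAB u a b := by
  rw [continuantAB_eq_evenCont_extendZero b hu, evenCont_mul_left huu]

theorem continuantAB_mul {n : ℕ} {u : R} {a b : Fin n → R} (huu : u * u = u)
    (hu : ∀ i, u * a i = a i) (hb : ∀ i, b i * u = b i) :
    continuantAB u a b * u = continuantAB u a b := by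
  rw [continuantAB_eq_evenCont_extendZero b hu, evenCont_mul_right huu (extendZero_mul hb)]

end Recursion

section System

variable {k : Type*} [Field k] {A : Type*} [Ring A] [Algebra k A] {e : Fin 2 → A}
  {D : DoubleBracket k e} {n : ℕ} {a b : ℕ → A}

namespace EulerSystem

theorem evenCont_e (h : EulerSystem D n a b) (i : ℕ) :
    evenCont (e 1) a b i * e 1 = evenCont (e 1) a b i :=
  evenCont_mul_right (h.idem.idem 1) h.b_e i

theorem oddCont_e (h : EulerSystem D n a b) (i : ℕ) :
    oddCont (e 1) a b i * e 0 = oddCont (e 1) a b i := by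
  induction i with
  | zero => rw [oddCont_zero, zero_mul]
  | succ i ih => rw [oddCont_succ, add_mul, mul_assoc, h.a_e, ih]

theorem br_oddCont_succ (D : DoubleBracket k e) (a b : ℕ → A) (i : ℕ) (x : A) :
    D.br (oddCont (e 1) a b (i + 1)) x =
      (1 ⊗ₜ evenCont (e 1) a b i) * D.br (a i) x + D.br (evenCont (e 1) a b i) x * (a i ⊗ₜ 1) +
        D.br (oddCont (e 1) a b i) x := by
  rw [oddCont_succ, map_add, LinearMap.add_apply, D.br_mul_left]

theorem br_evenCont_succ (D : DoubleBracket k e) (a b : ℕ → A) (i : ℕ) (x : A) :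
    D.br (evenCont (e 1) a b (i + 1)) x =
      (1 ⊗ₜ oddCont (e 1) a b (i + 1)) * D.br (b i) x +
        D.br (oddCont (e 1) a b (i + 1)) x * (b i ⊗ₜ 1) + D.br (evenCont (e 1) a b i) x := by
  rw [evenCont_succ, map_add, LinearMap.add_apply, D.br_mul_left]

/-- The bracket of continuants with an arrow `a_q` beyond their last letter.  The extra term for the
continuant that ends just before `a_q` comes from the constant term in the bracket of `b_{q-1}` and
`a_q`. -/
theorem br_cont_a_of_le [CharZero k] (h : EulerSystem D n a b) {q : ℕ} (hq : q < n) {i : ℕ}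
    (hi : i ≤ q) :
    D.br (evenCont (e 1) a b i) (a q) = (1 / 2 : k) • (e 1 ⊗ₜ (evenCont (e 1) a b i * a q) -
      evenCont (e 1) a b i ⊗ₜ a q) +
        (if i = q then e 1 ⊗ₜ[k] oddCont (e 1) a b i else 0) ∧
    D.br (oddCont (e 1) a b i) (a q) = -(1 / 2 : k) • (oddCont (e 1) a b i ⊗ₜ a q +
      a q ⊗ₜ oddCont (e 1) a b i) := by
  induction i with
  | zero =>
    simp [evenCont_zero, oddCont_zero, D.br_e_left, h.e_a]
  | succ i ih =>
    obtain ⟨ihE, ihO⟩ := ih (by omega)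
    have hO : D.br (oddCont (e 1) a b (i + 1)) (a q) =
        -(1 / 2 : k) • (oddCont (e 1) a b (i + 1) ⊗ₜ a q + a q ⊗ₜ oddCont (e 1) a b (i + 1)) := by
      rw [br_oddCont_succ, ihE, ihO, h.br_aa i (by omega) q hq, if_neg (by omega), oddCont_succ,
        sgnDiff, if_pos (by omega)]
      simp only [mul_smul_comm, smul_mul_assoc, mul_add, sub_mul, add_zero,
        Algebra.TensorProduct.tmul_mul_tmul, one_mul, mul_one, h.e_a,
        TensorProduct.tmul_add, TensorProduct.add_tmul]
      module
    refine ⟨?_, hO⟩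
    rw [br_evenCont_succ, hO, ihE, h.br_ba (by omega) hq, if_neg (by omega), evenCont_succ,
      sgnAB, if_neg (by omega), coeffAB, if_neg (by omega)]
    simp only [mul_smul_comm, smul_mul_assoc, mul_add, add_mul, add_zero,
      Algebra.TensorProduct.tmul_mul_tmul, one_mul, mul_one, mul_assoc,
      TensorProduct.tmul_add, TensorProduct.add_tmul, h.oddCont_e, eq_comm (a := q)]
    split_ifs <;> module

/-- The bracket of continuants with one of their letters `a_q`. -/
theorem br_cont_a_of_gt [CharZero k] (h : EulerSystem D n a b) {q : ℕ} {i : ℕ}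
    (hi : q < i) (hn : i ≤ n) :
    D.br (evenCont (e 1) a b i) (a q) = -(1 / 2 : k) • (e 1 ⊗ₜ (evenCont (e 1) a b i * a q) +
      evenCont (e 1) a b i ⊗ₜ a q) ∧
    D.br (oddCont (e 1) a b i) (a q) = (1 / 2 : k) • (a q ⊗ₜ oddCont (e 1) a b i -
      oddCont (e 1) a b i ⊗ₜ a q) := by
  have hq : q < n := by omega
  induction i, hi using Nat.le_induction with
  | base =>
    obtain ⟨hE, hO⟩ := h.br_cont_a_of_le hq le_rfl
    have hO' : D.br (oddCont (e 1) a b (q + 1)) (a q) =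
        (1 / 2 : k) • (a q ⊗ₜ oddCont (e 1) a b (q + 1) - oddCont (e 1) a b (q + 1) ⊗ₜ a q) := by
      rw [br_oddCont_succ, hE, hO, h.br_aa q hq q hq, if_pos rfl, sgnDiff_self, oddCont_succ]
      simp only [smul_mul_assoc, add_mul, sub_mul, mul_zero, zero_smul,
        Algebra.TensorProduct.tmul_mul_tmul, mul_one, h.e_a,
        TensorProduct.tmul_add, TensorProduct.add_tmul]
      module
    refine ⟨?_, hO'⟩
    rw [br_evenCont_succ, hO', hE, h.br_ba hq hq, if_pos rfl, evenCont_succ,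
      sgnAB, if_pos le_rfl, coeffAB, if_pos rfl]
    simp only [mul_smul_comm, smul_mul_assoc, mul_add, add_mul, sub_mul,
      Algebra.TensorProduct.tmul_mul_tmul, one_mul, mul_one, mul_assoc,
      TensorProduct.tmul_add, TensorProduct.add_tmul, h.oddCont_e]
    rw [oddCont_succ]
    simp only [add_mul, mul_assoc, TensorProduct.tmul_add, TensorProduct.add_tmul]
    module
  | succ i hi ih =>
    obtain ⟨hE, hO⟩ := ih (by omega)
    have hO' : D.br (oddCont (e 1) a b (i + 1)) (a q) =
        (1 / 2 : k) • (a q ⊗ₜ oddCont (e 1) a b (i + 1) - oddCont (e 1) a b (i + 1) ⊗ₜ a q) := by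
      rw [br_oddCont_succ, hE, hO, h.br_aa i (by omega) q hq, sgnDiff, if_neg (by omega),
        if_neg (by omega), oddCont_succ]
      simp only [mul_smul_comm, smul_mul_assoc, mul_add, add_mul,
        Algebra.TensorProduct.tmul_mul_tmul, one_mul, mul_one, h.e_a,
        TensorProduct.tmul_add, TensorProduct.add_tmul]
      module
    refine ⟨?_, hO'⟩
    rw [br_evenCont_succ, hO', hE, h.br_ba (by omega) hq, evenCont_succ,
      sgnAB, if_pos (by omega), coeffAB, if_neg (by omega), if_neg (by omega)]
    simp only [mul_smul_comm, smul_mul_assoc, mul_add, add_mul, sub_mul,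
      Algebra.TensorProduct.tmul_mul_tmul, one_mul, mul_one, mul_assoc,
      TensorProduct.tmul_add, TensorProduct.add_tmul, h.oddCont_e]
    module

/-- The bracket of continuants with an arrow `b_q` beyond the letter following their last one. -/
theorem br_cont_b_of_le [CharZero k] (h : EulerSystem D n a b) {q : ℕ} (hq : q < n) {i : ℕ}
    (hi : i ≤ q) :
    D.br (evenCont (e 1) a b i) (b q) = (1 / 2 : k) • ((b q * evenCont (e 1) a b i) ⊗ₜ e 1 -
      b q ⊗ₜ evenCont (e 1) a b i) ∧
    D.br (oddCont (e 1) a b i) (b q) = (1 / 2 : k) • (e 0 ⊗ₜ (oddCont (e 1) a b i * b q) +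
      (b q * oddCont (e 1) a b i) ⊗ₜ e 1) := by
  induction i with
  | zero =>
    simp [evenCont_zero, oddCont_zero, D.br_e_left, h.b_e]
  | succ i ih =>
    obtain ⟨hE, hO⟩ := ih (by omega)
    have hO' : D.br (oddCont (e 1) a b (i + 1)) (b q) =
        (1 / 2 : k) • (e 0 ⊗ₜ (oddCont (e 1) a b (i + 1) * b q) +
          (b q * oddCont (e 1) a b (i + 1)) ⊗ₜ e 1) := by
      rw [br_oddCont_succ, hE, hO, h.br_ab i (by omega) q hq, oddCont_succ,
        sgnAB, if_pos (by omega), coeffAB, if_neg (by omega), if_neg (by omega)]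
      simp only [mul_smul_comm, smul_mul_assoc, mul_add, add_mul, sub_mul,
        Algebra.TensorProduct.tmul_mul_tmul, one_mul, mul_one, mul_assoc, h.evenCont_e,
        TensorProduct.tmul_add, TensorProduct.add_tmul]
      module
    refine ⟨?_, hO'⟩
    rw [br_evenCont_succ, hO', hE, h.br_bb i (by omega) q hq, evenCont_succ, sgnDiff,
      if_pos (by omega)]
    simp only [mul_smul_comm, smul_mul_assoc, mul_add, add_mul,
      Algebra.TensorProduct.tmul_mul_tmul, one_mul, mul_one, h.e_b, mul_assoc,
      TensorProduct.tmul_add, TensorProduct.add_tmul]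
    module

/-- The bracket of continuants with one of their letters `b_q`, and with `b_q` for the continuant
that ends in `a_q`; in the latter case there is an extra term as in `br_cont_a_of_le`. -/
theorem br_cont_b_of_gt [CharZero k] (h : EulerSystem D n a b) {q : ℕ} {i : ℕ}
    (hi : q < i) (hn : i ≤ n) :
    D.br (evenCont (e 1) a b i) (b q) = (1 / 2 : k) • (b q ⊗ₜ evenCont (e 1) a b i +
      (b q * evenCont (e 1) a b i) ⊗ₜ e 1) ∧
    D.br (oddCont (e 1) a b i) (b q) = if i = q + 1 then
      (1 / 2 : k) • (e 0 ⊗ₜ (oddCont (e 1) a b i * b q) +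
        (b q * oddCont (e 1) a b i) ⊗ₜ e 1) + e 0 ⊗ₜ evenCont (e 1) a b q
      else (1 / 2 : k) • ((b q * oddCont (e 1) a b i) ⊗ₜ e 1 -
        e 0 ⊗ₜ (oddCont (e 1) a b i * b q)) := by
  have hq : q < n := by omega
  induction i, hi using Nat.le_induction with
  | base =>
    obtain ⟨hE, hO⟩ := h.br_cont_b_of_le hq le_rfl
    have hO' : D.br (oddCont (e 1) a b (q + 1)) (b q) =
        (1 / 2 : k) • (e 0 ⊗ₜ (oddCont (e 1) a b (q + 1) * b q) +
        (b q * oddCont (e 1) a b (q + 1)) ⊗ₜ e 1) + e 0 ⊗ₜ evenCont (e 1) a b q := by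
      rw [br_oddCont_succ, hE, hO, h.br_ab q hq q hq, oddCont_succ, sgnAB, if_pos le_rfl, coeffAB,
        if_pos rfl]
      simp only [mul_smul_comm, smul_mul_assoc, mul_add, add_mul, sub_mul,
        Algebra.TensorProduct.tmul_mul_tmul, one_mul, mul_one, mul_assoc, h.evenCont_e,
        TensorProduct.tmul_add, TensorProduct.add_tmul]
      module
    refine ⟨?_, by rw [if_pos rfl, hO']⟩
    rw [br_evenCont_succ, hO', hE, h.br_bb q hq q hq, sgnDiff_self, evenCont_succ]
    simp only [mul_zero, zero_smul, smul_mul_assoc, mul_add, add_mul,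
      Algebra.TensorProduct.tmul_mul_tmul, mul_one, h.e_b, mul_assoc,
      TensorProduct.tmul_add, TensorProduct.add_tmul]
    module
  | succ i hi ih =>
    obtain ⟨hE, hO⟩ := ih (by omega)
    have hO' : D.br (oddCont (e 1) a b (i + 1)) (b q) =
        (1 / 2 : k) • ((b q * oddCont (e 1) a b (i + 1)) ⊗ₜ e 1 -
          e 0 ⊗ₜ (oddCont (e 1) a b (i + 1) * b q)) := by
      rw [br_oddCont_succ, hE, hO, h.br_ab i (by omega) q hq, oddCont_succ, sgnAB,
        if_neg (by omega), coeffAB, if_neg (by omega)]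
      by_cases hiq : i = q + 1
      · subst hiq
        rw [if_pos rfl, if_pos rfl, evenCont_succ]
        simp only [mul_smul_comm, smul_mul_assoc, mul_add, add_mul, h.b_e,
          Algebra.TensorProduct.tmul_mul_tmul, one_mul, mul_one, mul_assoc,
          h.evenCont_e, TensorProduct.tmul_add, TensorProduct.add_tmul]
        module
      · rw [if_neg hiq, if_neg hiq]
        simp only [mul_smul_comm, smul_mul_assoc, mul_add, add_mul,
          Algebra.TensorProduct.tmul_mul_tmul, one_mul, mul_one, mul_assoc,
          h.evenCont_e, TensorProduct.tmul_add, TensorProduct.add_tmul]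
        module
    refine ⟨?_, by rw [if_neg (by omega), hO']⟩
    rw [br_evenCont_succ, hO', hE, h.br_bb i (by omega) q hq, evenCont_succ, sgnDiff,
      if_neg (by omega), if_neg (by omega)]
    simp only [mul_smul_comm, smul_mul_assoc, mul_add, sub_mul,
      Algebra.TensorProduct.tmul_mul_tmul, one_mul, mul_one, h.e_b, mul_assoc,
      TensorProduct.tmul_add, TensorProduct.add_tmul]
    module

/-- The moment map identity for the continuant `(a₁, b₁, …, a_n, b_n)` on an arrow. -/
theorem br_evenCont_generators [CharZero k] (h : EulerSystem D n a b) {x : A}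
    (hx : (∃ i < n, x = a i) ∨ ∃ i < n, x = b i) :
    D.br (evenCont (e 1) a b n) x = (1 / 2 : k) •
      ((x * e 1) ⊗ₜ[k] evenCont (e 1) a b n - e 1 ⊗ₜ[k] (evenCont (e 1) a b n * x)
        + (x * evenCont (e 1) a b n) ⊗ₜ[k] e 1 - evenCont (e 1) a b n ⊗ₜ[k] (e 1 * x)) := by
  obtain ⟨q, hq, rfl⟩ | ⟨q, hq, rfl⟩ := hx
  · have h1 : a q * evenCont (e 1) a b n = 0 := by
      rw [← evenCont_mul_left (h.idem.idem 1), ← mul_assoc, h.a_e_zero, zero_mul]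
    rw [(h.br_cont_a_of_gt hq le_rfl).1, h1, h.a_e_zero, h.e_a, TensorProduct.zero_tmul,
      TensorProduct.zero_tmul]
    module
  · have h1 : evenCont (e 1) a b n * b q = 0 := by
      rw [← h.evenCont_e, mul_assoc, h.e_b_zero, mul_zero]
    rw [(h.br_cont_b_of_gt hq le_rfl).1, h1, h.b_e, h.e_b_zero, TensorProduct.tmul_zero,
      TensorProduct.tmul_zero]
    module

end EulerSystem
end System

/-! ### Derivations of the Boalch algebra -/

section Relations

variable (k : Type*) [Field k] (n : ℕ)

theorem PathAlgebra.gen_e_mul (s t : Fin 2) : gen k n (.e s) * gen k n (.e t) =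
    if s = t then gen k n (.e s) else 0 := by
  have h := RingQuot.mkAlgHom_rel k (PathRel.e_mul (k := k) (n := n) s t)
  rw [map_mul] at h
  refine h.trans ?_
  split_ifs
  · rfl
  · exact map_zero _

theorem PathAlgebra.gen_e_sum : gen k n (.e 0) + gen k n (.e 1) = 1 := by
  have h := RingQuot.mkAlgHom_rel k (PathRel.e_sum (k := k) (n := n))
  rwa [map_add, map_one] at h

theorem PathAlgebra.gen_a_ends (i : Fin n) :
    gen k n (.a i) = gen k n (.e 1) * gen k n (.a i) * gen k n (.e 0) := by
  have h := RingQuot.mkAlgHom_rel k (PathRel.a_ends (k := k) (n := n) i)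
  rwa [map_mul, map_mul] at h

theorem PathAlgebra.gen_b_ends (i : Fin n) :
    gen k n (.b i) = gen k n (.e 0) * gen k n (.b i) * gen k n (.e 1) := by
  have h := RingQuot.mkAlgHom_rel k (PathRel.b_ends (k := k) (n := n) i)
  rwa [map_mul, map_mul] at h

theorem PathAlgebra.gen_e_mul_a (i : Fin n) :
    gen k n (.e 1) * gen k n (.a i) = gen k n (.a i) := by
  rw [gen_a_ends, ← mul_assoc, ← mul_assoc, gen_e_mul, if_pos rfl]

theorem PathAlgebra.gen_a_mul_e (i : Fin n) :
    gen k n (.a i) * gen k n (.e 0) = gen k n (.a i) := by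
  rw [gen_a_ends, mul_assoc, gen_e_mul, if_pos rfl]

theorem PathAlgebra.gen_e_mul_b (i : Fin n) :
    gen k n (.e 0) * gen k n (.b i) = gen k n (.b i) := by
  rw [gen_b_ends, ← mul_assoc, ← mul_assoc, gen_e_mul, if_pos rfl]

theorem PathAlgebra.gen_b_mul_e (i : Fin n) :
    gen k n (.b i) * gen k n (.e 1) = gen k n (.b i) := by
  rw [gen_b_ends, mul_assoc, gen_e_mul, if_pos rfl]

theorem PathAlgebra.e_mul_eulerAB : gen k n (.e 1) * eulerAB k n = eulerAB k n :=
  mul_continuantAB _ (by rw [gen_e_mul, if_pos rfl]) (gen_e_mul_a k n)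

theorem PathAlgebra.eulerAB_mul_e : eulerAB k n * gen k n (.e 1) = eulerAB k n :=
  continuantAB_mul (by rw [gen_e_mul, if_pos rfl]) (gen_e_mul_a k n) (gen_b_mul_e k n)

theorem PathAlgebra.e_mul_eulerBA : gen k n (.e 0) * eulerBA k n = eulerBA k n := by
  rw [eulerBA, continuantBA_eq_continuantAB]
  exact mul_continuantAB _ (by rw [gen_e_mul, if_pos rfl]) fun i => gen_e_mul_b k n _

theorem PathAlgebra.eulerBA_mul_e : eulerBA k n * gen k n (.e 0) = eulerBA k n := by
  rw [eulerBA, continuantBA_eq_continuantAB]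
  exact continuantAB_mul (by rw [gen_e_mul, if_pos rfl]) (fun i => gen_e_mul_b k n _)
    fun i => gen_a_mul_e k n _

namespace BoalchAlgebra

theorem ofPath_eulerAB : ofPath k n (PathAlgebra.eulerAB k n) = eulerAB k n := by
  refine (map_continuantAB (ofPath k n).toRingHom _ _ _).trans ?_
  simp only [AlgHom.toRingHom_eq_coe, RingHom.coe_coe, ofPath_gen]
  rfl

theorem ofPath_eulerBA : ofPath k n (PathAlgebra.eulerBA k n) = eulerBA k n := by
  refine (map_continuantBA (ofPath k n).toRingHom _ _ _).trans ?_
  simp only [AlgHom.toRingHom_eq_coe, RingHom.coe_coe, ofPath_gen]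
  rfl

theorem e_mul_e (s t : Fin 2) : e k n s * e k n t = if s = t then e k n s else 0 := by
  have h := congrArg (ofPath k n) (PathAlgebra.gen_e_mul k n s t)
  rw [map_mul, ofPath_gen, ofPath_gen] at h
  refine h.trans ?_
  split_ifs
  · exact ofPath_gen k n _
  · exact map_zero _

theorem e_sum : e k n 0 + e k n 1 = 1 := by
  have h := congrArg (ofPath k n) (PathAlgebra.gen_e_sum k n)
  rwa [map_add, ofPath_gen, ofPath_gen, map_one] at h

theorem completeOrthogonalIdempotents : CompleteOrthogonalIdempotents (e k n) where
  idem s := by rw [IsIdempotentElem, e_mul_e, if_pos rfl]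
  ortho s t h := by
    change e k n s * e k n t = 0
    rw [e_mul_e, if_neg h]
  complete := by rw [Fin.sum_univ_two, e_sum]

theorem e_mul_a (i : Fin n) : e k n 1 * a k n i = a k n i := by
  have h := congrArg (ofPath k n) (PathAlgebra.gen_e_mul_a k n i)
  rwa [map_mul, ofPath_gen, ofPath_gen] at h

theorem a_mul_e (i : Fin n) : a k n i * e k n 0 = a k n i := by
  have h := congrArg (ofPath k n) (PathAlgebra.gen_a_mul_e k n i)
  rwa [map_mul, ofPath_gen, ofPath_gen] at h

theorem e_mul_b (i : Fin n) : e k n 0 * b k n i = b k n i := by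
  have h := congrArg (ofPath k n) (PathAlgebra.gen_e_mul_b k n i)
  rwa [map_mul, ofPath_gen, ofPath_gen] at h

theorem b_mul_e (i : Fin n) : b k n i * e k n 1 = b k n i := by
  have h := congrArg (ofPath k n) (PathAlgebra.gen_b_mul_e k n i)
  rwa [map_mul, ofPath_gen, ofPath_gen] at h

theorem e_mul_inv (s : Fin 2) : e k n s * gen k n (.inv s) = gen k n (.inv s) := by
  have h := RingQuot.mkAlgHom_rel k (BoalchRel.e_inv (k := k) (n := n) s)
  rwa [map_mul] at h

theorem inv_mul_e (s : Fin 2) : gen k n (.inv s) * e k n s = gen k n (.inv s) := by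
  have h := RingQuot.mkAlgHom_rel k (BoalchRel.inv_e (k := k) (n := n) s)
  rwa [map_mul] at h

theorem e_mul_eulerAB : e k n 1 * eulerAB k n = eulerAB k n :=
  mul_continuantAB _ (by rw [e_mul_e, if_pos rfl]) (e_mul_a k n)

theorem eulerAB_mul_e : eulerAB k n * e k n 1 = eulerAB k n :=
  continuantAB_mul (by rw [e_mul_e, if_pos rfl]) (e_mul_a k n) (b_mul_e k n)

theorem eulerBA_eq : eulerBA k n =
    continuantAB (e k n 0) (fun i => b k n i.rev) (fun i => a k n i.rev) :=
  continuantBA_eq_continuantAB _ _ _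

theorem e_mul_eulerBA : e k n 0 * eulerBA k n = eulerBA k n := by
  rw [eulerBA_eq]
  exact mul_continuantAB _ (by rw [e_mul_e, if_pos rfl]) fun i => e_mul_b k n _

theorem eulerBA_mul_e : eulerBA k n * e k n 0 = eulerBA k n := by
  rw [eulerBA_eq]
  exact continuantAB_mul (by rw [e_mul_e, if_pos rfl]) (fun i => e_mul_b k n _)
    fun i => a_mul_e k n _

/-- The two elements which are inverted locally, indexed by their vertices. -/
def loop : Fin 2 → BoalchAlgebra k n := ![eulerBA k n, eulerAB k n]

theorem inv_mul_loop (s : Fin 2) : gen k n (.inv s) * loop k n s = e k n s := by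
  fin_cases s
  · exact eulerBAInv_mul k n
  · exact eulerABInv_mul k n

theorem loop_mul_inv (s : Fin 2) : loop k n s * gen k n (.inv s) = e k n s := by
  fin_cases s
  · exact eulerBA_mul_inv k n
  · exact eulerAB_mul_inv k n

@[elab_as_elim]
theorem induction {P : BoalchAlgebra k n → Prop} (algebraMap : ∀ c, P (algebraMap k _ c))
    (gen : ∀ x, P (gen k n x)) (add : ∀ x y, P x → P y → P (x + y))
    (mul : ∀ x y, P x → P y → P (x * y)) (x : BoalchAlgebra k n) : P x := by
  obtain ⟨y, rfl⟩ := RingQuot.mkAlgHom_surjective k (BoalchRel k n) x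
  induction y using FreeAlgebra.induction with
  | grade0 c => rw [AlgHom.commutes]; exact algebraMap c
  | grade1 x => exact gen x
  | mul x y hx hy => rw [map_mul]; exact mul _ _ hx hy
  | add x y hx hy => rw [map_add]; exact add _ _ hx hy

end BoalchAlgebra

end Relations

section Derivations

variable {k : Type*} [Field k] {n : ℕ} {T : Type*} [Ring T] [Algebra k T]

open BoalchAlgebra

theorem IsDerivationAlong.continuantRev_eq_zero {A : Type*} [Ring A] [Algebra k A]
    {l r : A →ₐ[k] T} {d : A → T} (h : IsDerivationAlong l r d) {u : A} (hu : d u = 0) :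
    ∀ L : List A, (∀ y ∈ L, d y = 0) → d (continuantRev u L) = 0
  | [], _ => hu
  | [y], hL => hL y (by simp)
  | y :: z :: L, hL => by
    rw [continuantRev, h.map_add, h.map_mul,
      h.continuantRev_eq_zero hu (z :: L) (fun w hw => hL w (List.mem_cons_of_mem _ hw)),
      h.continuantRev_eq_zero hu L (fun w hw => hL w (by simp [hw])), hL y (by simp)]
    simp

/-- A derivation of the Boalch algebra which vanishes on the idempotents and the arrows is zero:
its values on the local inverses of the continuants are determined by the Leibniz rule. -/
theorem IsDerivationAlong.eq_zero {l r : BoalchAlgebra k n →ₐ[k] T} {d : BoalchAlgebra k n → T}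
    (h : IsDerivationAlong l r d) (he : ∀ s, d (e k n s) = 0) (ha : ∀ i, d (a k n i) = 0)
    (hb : ∀ i, d (b k n i) = 0) (x : BoalchAlgebra k n) : d x = 0 := by
  have hloop : ∀ s, d (loop k n s) = 0 := fun s => by
    fin_cases s
    · refine h.continuantRev_eq_zero (he 0) _ fun y hy => ?_
      simp only [List.mem_reverse, List.mem_flatMap, List.mem_cons, List.not_mem_nil,
        or_false] at hy
      obtain ⟨i, -, rfl | rfl⟩ := hy
      exacts [hb i, ha i]
    · refine h.continuantRev_eq_zero (he 1) _ fun y hy => ?_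
      simp only [List.mem_reverse, List.mem_flatMap, List.mem_cons, List.not_mem_nil,
        or_false] at hy
      obtain ⟨i, -, rfl | rfl⟩ := hy
      exacts [ha i, hb i]
  induction x using BoalchAlgebra.induction with
  | algebraMap c => rw [Algebra.algebraMap_eq_smul_one, h.map_smul, h.map_one, smul_zero]
  | gen x =>
    match x with
    | .path (.e s) => exact he s
    | .path (.a i) => exact ha i
    | .path (.b i) => exact hb i
    | .inv s =>
      have h1 : l (loop k n s) * d (gen k n (.inv s)) = 0 := by
        have := h.map_mul (loop k n s) (gen k n (.inv s))
        rwa [loop_mul_inv, he, hloop, zero_mul, add_zero, eq_comm] at this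
      rw [← e_mul_inv, h.map_mul, he, zero_mul, add_zero, ← inv_mul_loop, _root_.map_mul,
        mul_assoc, h1, mul_zero]
  | add x y hx hy => rw [h.map_add, hx, hy, add_zero]
  | mul x y hx hy => rw [h.map_mul, hx, hy, mul_zero, zero_mul, add_zero]

/-- Derivations of the Boalch algebra are determined by their values on the idempotents and the
arrows. -/
theorem IsDerivationAlong.ext_arrows {l r : BoalchAlgebra k n →ₐ[k] T}
    {d d' : BoalchAlgebra k n → T} (h : IsDerivationAlong l r d) (h' : IsDerivationAlong l r d')
    (he : ∀ s, d (e k n s) = d' (e k n s)) (ha : ∀ i, d (a k n i) = d' (a k n i))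
    (hb : ∀ i, d (b k n i) = d' (b k n i)) (x : BoalchAlgebra k n) : d x = d' x :=
  sub_eq_zero.mp <| (h.sub h').eq_zero (fun s => sub_eq_zero.mpr (he s))
    (fun i => sub_eq_zero.mpr (ha i)) (fun i => sub_eq_zero.mpr (hb i)) x

/-- A morphism to `2 × 2` matrices which is upper triangular with diagonal `(p, q)` on generators
is so everywhere. -/
theorem upperTriangular_of_generators {X : Type*}
    (g : FreeAlgebra k X →ₐ[k] Matrix (Fin 2) (Fin 2) T) (p q : FreeAlgebra k X →ₐ[k] T)
    (h : ∀ x, g (FreeAlgebra.ι k x) 0 0 = p (FreeAlgebra.ι k x) ∧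
      g (FreeAlgebra.ι k x) 1 0 = 0 ∧ g (FreeAlgebra.ι k x) 1 1 = q (FreeAlgebra.ι k x))
    (y : FreeAlgebra k X) : g y 0 0 = p y ∧ g y 1 0 = 0 ∧ g y 1 1 = q y := by
  induction y using FreeAlgebra.induction with
  | grade0 c => simp [Matrix.algebraMap_eq_diagonal]
  | grade1 x => exact h x
  | mul x y hx hy =>
    simp only [map_mul, Matrix.mul_apply, Fin.sum_univ_two, hx.1, hx.2.1, hx.2.2, hy.1, hy.2.1,
      hy.2.2, mul_zero, zero_mul, add_zero, zero_add, true_and]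
  | add x y hx hy =>
    simp only [map_add, Matrix.add_apply, hx.1, hx.2.1, hx.2.2, hy.1, hy.2.1, hy.2.2, add_zero,
      true_and]

/-- There is a derivation of the Boalch algebra which vanishes on the idempotents and has prescribed
values on the arrows, subject only to the constraint imposed by the end points of the arrows.  It is
the upper right entry of a morphism to upper triangular matrices. -/
theorem exists_isDerivationAlong (l r : BoalchAlgebra k n →ₐ[k] T) (v w : Fin n → T)
    (hv : ∀ i, l (e k n 1) * v i * r (e k n 0) = v i)
    (hw : ∀ i, l (e k n 0) * w i * r (e k n 1) = w i) :
    ∃ d : BoalchAlgebra k n → T, IsDerivationAlong l r d ∧ (∀ s, d (e k n s) = 0) ∧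
      (∀ i, d (a k n i) = v i) ∧ ∀ i, d (b k n i) = w i := by
  let g : PathGen n → Matrix (Fin 2) (Fin 2) T := fun x => match x with
    | .e s => !![l (e k n s), 0; 0, r (e k n s)]
    | .a i => !![l (a k n i), v i; 0, r (a k n i)]
    | .b i => !![l (b k n i), w i; 0, r (b k n i)]
  have hg : ∀ ⦃x y⦄, PathRel k n x y → FreeAlgebra.lift k g x = FreeAlgebra.lift k g y := by
    intro x y hxy
    cases hxy with
    | e_mul s t =>
      rw [map_mul, FreeAlgebra.lift_ι_apply, FreeAlgebra.lift_ι_apply]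
      split_ifs with hst
      · subst hst
        simp [g, ← map_mul, e_mul_e]
      · simp only [g, Matrix.mul_fin_two, ← map_mul, e_mul_e, if_neg hst]
        ext i j
        fin_cases i <;> fin_cases j <;> simp
    | e_sum =>
      simp only [map_add, map_one, FreeAlgebra.lift_ι_apply, g, Matrix.one_fin_two]
      simp [← map_add, e_sum]
    | a_ends i =>
      simp only [map_mul, FreeAlgebra.lift_ι_apply, g, Matrix.mul_fin_two]
      simp [hv, ← map_mul, e_mul_a, a_mul_e]
    | b_ends i =>
      simp only [map_mul, FreeAlgebra.lift_ι_apply, g, Matrix.mul_fin_two]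
      simp [hw, ← map_mul, e_mul_b, b_mul_e]
  let f : PathAlgebra k n →ₐ[k] Matrix (Fin 2) (Fin 2) T :=
    RingQuot.liftAlgHom k ⟨FreeAlgebra.lift k g, hg⟩
  have hfg : ∀ x, f (PathAlgebra.gen k n x) = g x := fun x => by
    rw [PathAlgebra.gen, RingQuot.liftAlgHom_mkAlgHom_apply, FreeAlgebra.lift_ι_apply]
  have hf : ∀ x, f x 0 0 = l (ofPath k n x) ∧ f x 1 0 = 0 ∧ f x 1 1 = r (ofPath k n x) := by
    intro x
    obtain ⟨y, rfl⟩ := RingQuot.mkAlgHom_surjective k (PathRel k n) x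
    refine upperTriangular_of_generators (f.comp (RingQuot.mkAlgHom k (PathRel k n)))
      ((l.comp (ofPath k n)).comp (RingQuot.mkAlgHom k (PathRel k n)))
      ((r.comp (ofPath k n)).comp (RingQuot.mkAlgHom k (PathRel k n))) (fun z => ?_) y
    simp only [AlgHom.comp_apply]
    change f (PathAlgebra.gen k n z) 0 0 = l (ofPath k n (PathAlgebra.gen k n z)) ∧ 
      f (PathAlgebra.gen k n z) 1 0 = 0 ∧ 
      f (PathAlgebra.gen k n z) 1 1 = r (ofPath k n (PathAlgebra.gen k n z))
    rw [ofPath_gen, hfg]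
    cases z <;> exact ⟨rfl, rfl, rfl⟩
  let lp : Fin 2 → PathAlgebra k n := ![PathAlgebra.eulerBA k n, PathAlgebra.eulerAB k n]
  have hlp : ∀ s, ofPath k n (lp s) = loop k n s := fun s => by
    fin_cases s
    exacts [ofPath_eulerBA k n, ofPath_eulerAB k n]
  let X : Fin 2 → T := fun s => f (lp s) 0 1
  have hfl : ∀ s, f (lp s) = !![l (loop k n s), X s; 0, r (loop k n s)] := fun s => by
    rw [Matrix.eta_fin_two (f (lp s)), (hf _).1, (hf _).2.1, (hf _).2.2, hlp]
  have hfe : ∀ s, f (PathAlgebra.gen k n (.e s)) = !![l (e k n s), 0; 0, r (e k n s)] :=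
    fun s => hfg _
  have hXl : ∀ s, l (e k n s) * X s = X s := fun s => by
    have h : PathAlgebra.gen k n (.e s) * lp s = lp s := by
      fin_cases s
      exacts [PathAlgebra.e_mul_eulerBA k n, PathAlgebra.e_mul_eulerAB k n]
    have h2 := congrArg (fun M => f M 0 1) h
    simpa [hfe, hfl, Matrix.mul_fin_two] using h2
  have hXr : ∀ s, X s * r (e k n s) = X s := fun s => by
    have h : lp s * PathAlgebra.gen k n (.e s) = lp s := by
      fin_cases s
      exacts [PathAlgebra.eulerBA_mul_e k n, PathAlgebra.eulerAB_mul_e k n]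
    have h2 := congrArg (fun M => f M 0 1) h
    simpa [hfe, hfl, Matrix.mul_fin_two] using h2
  let y : Fin 2 → Matrix (Fin 2) (Fin 2) T := fun s =>
    !![l (gen k n (.inv s)), -(l (gen k n (.inv s)) * X s * r (gen k n (.inv s)));
      0, r (gen k n (.inv s))]
  have hyl : ∀ s, y s * f (lp s) = f (PathAlgebra.gen k n (.e s)) := fun s => by
    rw [hfl, hfe, Matrix.mul_fin_two]
    simp only [mul_zero, zero_mul, add_zero, zero_add, ← map_mul, inv_mul_loop, neg_mul]
    rw [mul_assoc _ (r _), ← map_mul, inv_mul_loop, mul_assoc, hXr, add_neg_cancel]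
  have hly : ∀ s, f (lp s) * y s = f (PathAlgebra.gen k n (.e s)) := fun s => by
    rw [hfl, hfe, Matrix.mul_fin_two]
    simp only [mul_zero, zero_mul, add_zero, zero_add, ← map_mul, loop_mul_inv, mul_neg, neg_zero]
    rw [← mul_assoc, ← mul_assoc, ← map_mul, loop_mul_inv, hXl, neg_add_cancel]
  obtain ⟨F, ⟨hF, hF1, hF0⟩, -⟩ := existsUnique_lift k n f y
    (fun s => by
      rw [hfe, Matrix.mul_fin_two]
      simp [y, ← mul_assoc, ← map_mul, e_mul_inv])
    (fun s => by
      rw [hfe, Matrix.mul_fin_two]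
      simp [y, mul_assoc, ← map_mul, inv_mul_e])
    (hyl 1) (hly 1) (hyl 0) (hly 0)
  have hFp : ∀ x, F (gen k n (.path x)) = g x := fun x => by
    rw [← ofPath_gen, ← AlgHom.comp_apply, hF, hfg]
  have hFi : ∀ s, F (gen k n (.inv s)) = y s := fun s => by
    fin_cases s
    exacts [hF0, hF1]
  have hFt : ∀ x, F x 0 0 = l x ∧ F x 1 0 = 0 ∧ F x 1 1 = r x := by
    intro x
    obtain ⟨y, rfl⟩ := RingQuot.mkAlgHom_surjective k (BoalchRel k n) x
    refine upperTriangular_of_generators (F.comp (RingQuot.mkAlgHom k (BoalchRel k n)))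
      (l.comp (RingQuot.mkAlgHom k (BoalchRel k n)))
      (r.comp (RingQuot.mkAlgHom k (BoalchRel k n))) (fun z => ?_) y
    change F (gen k n z) 0 0 = l (gen k n z) ∧ F (gen k n z) 1 0 = 0 ∧
      F (gen k n z) 1 1 = r (gen k n z)
    match z with
    | .path (.e s) => rw [hFp]; exact ⟨rfl, rfl, rfl⟩
    | .path (.a i) => rw [hFp]; exact ⟨rfl, rfl, rfl⟩
    | .path (.b i) => rw [hFp]; exact ⟨rfl, rfl, rfl⟩
    | .inv s => rw [hFi]; exact ⟨rfl, rfl, rfl⟩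
  refine ⟨fun x => F x 0 1, ⟨fun x y => ?_, fun c x => ?_, fun x y => ?_⟩, fun s => ?_, fun i => ?_,
    fun i => ?_⟩
  · rw [map_add, Matrix.add_apply]
  · rw [map_smul, Matrix.smul_apply]
  · rw [map_mul, Matrix.mul_apply, Fin.sum_univ_two, (hFt x).1, (hFt y).2.2]
  · exact congrFun (congrFun (hFp (.e s)) 0) 1
  · exact congrFun (congrFun (hFp (.a i)) 0) 1
  · exact congrFun (congrFun (hFp (.b i)) 0) 1

end Derivations

/-! ### Existence and uniqueness of the double bracket -/

section Existence

variable {k : Type*} [Field k] {n : ℕ}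

open BoalchAlgebra Algebra.TensorProduct

section Signs

variable {M : Type*} [AddCommGroup M] [Module k M]

theorem ite_eq_sgnDiff (i j : Fin n) (x y : M) :
    (if i < j then -((1 / 2 : k) • (x + y)) else if i = j then 0 else (1 / 2 : k) • (x + y)) =
      (1 / 2 * sgnDiff k i j) • (x + y) := by
  simp only [sgnDiff, Fin.lt_def, Fin.ext_iff]
  split_ifs <;> module

theorem ite_eq_sgnAB (i j : Fin n) (x y z : M) :
    (if i < j then (1 / 2 : k) • (x + y)
      else if i = j then (1 / 2 : k) • (y + x) + z
      else -((1 / 2 : k) • (y + x)) - (if (i : ℕ) = (j : ℕ) + 1 then z else 0)) =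
      (1 / 2 * sgnAB k i j) • (x + y) + coeffAB k i j • z := by
  simp only [sgnAB, coeffAB, Fin.lt_def, Fin.ext_iff]
  split_ifs <;> first | omega | module

theorem ite_eq_neg_sgnAB (i j : Fin n) (x y z : M) :
    (if i < j then (1 / 2 : k) • (x + y) + (if (j : ℕ) = (i : ℕ) + 1 then z else 0)
      else if i = j then -((1 / 2 : k) • (x + y)) - z
      else -((1 / 2 : k) • (y + x))) =
      (-(1 / 2) * sgnAB k j i) • (x + y) + (-coeffAB k j i) • z := by
  simp only [sgnAB, coeffAB, Fin.lt_def, Fin.ext_iff]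
  split_ifs <;> first | omega | module

end Signs

theorem isEulerBracket_iff (D : DoubleBracket k (e k n)) : IsEulerBracket k n D ↔
    (∀ i j : Fin n, D.br (a k n i) (a k n j) =
      (1 / 2 * sgnDiff k i j) • (a k n i ⊗ₜ[k] a k n j + a k n j ⊗ₜ[k] a k n i)) ∧
    (∀ i j : Fin n, D.br (b k n i) (b k n j) =
      (1 / 2 * sgnDiff k i j) • (b k n i ⊗ₜ[k] b k n j + b k n j ⊗ₜ[k] b k n i)) ∧
    (∀ i j : Fin n, D.br (a k n i) (b k n j) =
      (1 / 2 * sgnAB k i j) •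
        (e k n 0 ⊗ₜ[k] (a k n i * b k n j) + (b k n j * a k n i) ⊗ₜ[k] e k n 1)
        + coeffAB k i j • (e k n 0 ⊗ₜ[k] e k n 1)) ∧
    (∀ i j : Fin n, D.br (b k n i) (a k n j) =
      (-(1 / 2) * sgnAB k j i) •
        (e k n 1 ⊗ₜ[k] (b k n i * a k n j) + (a k n j * b k n i) ⊗ₜ[k] e k n 0)
        + (-coeffAB k j i) • (e k n 1 ⊗ₜ[k] e k n 0)) := by
  have hab := fun i j : Fin n => ite_eq_sgnAB (k := k) i j (e k n 0 ⊗ₜ[k] (a k n i * b k n j))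
    ((b k n j * a k n i) ⊗ₜ[k] e k n 1) (e k n 0 ⊗ₜ[k] e k n 1)
  have hba := fun i j : Fin n => ite_eq_neg_sgnAB (k := k) i j (e k n 1 ⊗ₜ[k] (b k n i * a k n j))
    ((a k n j * b k n i) ⊗ₜ[k] e k n 0) (e k n 1 ⊗ₜ[k] e k n 0)
  constructor
  · intro h
    refine ⟨fun i j => (h.aa i j).trans (ite_eq_sgnDiff i j _ _),
      fun i j => (h.bb i j).trans (ite_eq_sgnDiff i j _ _), fun i j => ?_, fun i j => ?_⟩
    · rw [h.ab, ← hab]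
      split_ifs with _ heq <;> first | rfl | (subst heq; rfl)
    · rw [h.ba, ← hba]
      split_ifs with _ _ heq <;> first | rfl | (subst heq; rfl)
  · rintro ⟨haa, hbb, hab', hba'⟩
    refine ⟨fun i j => (haa i j).trans (ite_eq_sgnDiff i j _ _).symm,
      fun i j => (hbb i j).trans (ite_eq_sgnDiff i j _ _).symm, fun i j => ?_, fun i j => ?_⟩
    · rw [hab', ← hab]
      split_ifs with _ heq <;> first | rfl | (subst heq; rfl)
    · rw [hba', ← hba]
      split_ifs with _ _ heq <;> first | rfl | (subst heq; rfl)

/-- A double bracket on the Boalch algebra is determined by its values on the arrows. -/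
theorem IsEulerBracket.eq {D D' : DoubleBracket k (e k n)} (h : IsEulerBracket k n D)
    (h' : IsEulerBracket k n D') : D = D' := by
  refine DoubleBracket.ext (LinearMap.ext fun x => LinearMap.ext fun y => ?_)
  refine (D.isDerivationAlong_br_left y).ext_arrows (D'.isDerivationAlong_br_left y)
    (fun s => by rw [D.br_e_left, D'.br_e_left]) (fun i => ?_) (fun i => ?_) x
  · exact (D.isDerivationAlong_br _).ext_arrows (D'.isDerivationAlong_br _)
      (fun s => by rw [D.br_e, D'.br_e]) (fun j => by rw [h.aa, h'.aa])
      (fun j => by rw [h.ab, h'.ab]) y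
  · exact (D.isDerivationAlong_br _).ext_arrows (D'.isDerivationAlong_br _)
      (fun s => by rw [D.br_e, D'.br_e]) (fun j => by rw [h.ba, h'.ba])
      (fun j => by rw [h.bb, h'.bb]) y

section Flip

variable {A : Type*} [Ring A] [Algebra k A]

theorem commute_includeRight_includeLeft (x y : A) :
    Commute (1 ⊗ₜ[k] x : A ⊗[k] A) (y ⊗ₜ[k] 1) := by
  simp [Commute, SemiconjBy]

theorem eq_neg_comm_symm {x y : A ⊗[k] A} (h : x = -TensorProduct.comm k A A y) :
    y = -TensorProduct.comm k A A x := by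
  rw [h, map_neg, DoubleBracket.comm_comm, neg_neg]

theorem zero_eq_neg_comm : (0 : A ⊗[k] A) = -TensorProduct.comm k A A 0 := by
  rw [map_zero, neg_zero]

/-- The flip exchanges the constraints on end points for the two bimodule structures. -/
theorem inner_of_outer {v w : A ⊗[k] A} {s t : A} (hw : w = -TensorProduct.comm k A A v)
    (h : (s ⊗ₜ 1) * w * (1 ⊗ₜ t) = w) : (1 ⊗ₜ s) * v * (t ⊗ₜ 1) = v := by
  have h2 := congrArg (TensorProduct.comm k A A) h
  rw [DoubleBracket.comm_mul, DoubleBracket.comm_mul, TensorProduct.comm_tmul,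
    TensorProduct.comm_tmul, hw, map_neg, DoubleBracket.comm_comm, mul_neg, neg_mul] at h2
  exact neg_injective h2

theorem IsDerivationAlong.neg_comm {d : A → A ⊗[k] A}
    (h : IsDerivationAlong (includeRight : A →ₐ[k] A ⊗[k] A) includeLeft d) :
    IsDerivationAlong (includeLeft : A →ₐ[k] A ⊗[k] A) includeRight
      (fun z => -TensorProduct.comm k A A (d z)) where
  map_add y z := by rw [h.map_add, _root_.map_add, neg_add]
  map_smul c z := by rw [h.map_smul, _root_.map_smul, smul_neg]
  map_mul y z := by
    rw [h.map_mul, _root_.map_add, DoubleBracket.comm_mul, DoubleBracket.comm_mul, neg_add,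
      mul_neg, neg_mul]
    rfl

end Flip

/-- A double bracket exists with prescribed values on pairs of arrows, subject to antisymmetry and
to the constraint that `{{x, y}}` lies in `e_{t(y)} A e_{s(x)} ⊗ e_{t(x)} A e_{s(y)}`.  Derivations
in the second argument are constructed first, for each arrow in the first argument; these are then
the values on arrows of derivations in the first argument. -/
theorem exists_doubleBracket
    (vaa vab vba vbb : Fin n → Fin n → BoalchAlgebra k n ⊗[k] BoalchAlgebra k n)
    (saa : ∀ i j, vaa i j = -TensorProduct.comm k _ _ (vaa j i))
    (sab : ∀ i j, vab i j = -TensorProduct.comm k _ _ (vba j i))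
    (sbb : ∀ i j, vbb i j = -TensorProduct.comm k _ _ (vbb j i))
    (oaa : ∀ i j, (e k n 1 ⊗ₜ 1) * vaa i j * (1 ⊗ₜ e k n 0) = vaa i j)
    (oab : ∀ i j, (e k n 0 ⊗ₜ 1) * vab i j * (1 ⊗ₜ e k n 1) = vab i j)
    (oba : ∀ i j, (e k n 1 ⊗ₜ 1) * vba i j * (1 ⊗ₜ e k n 0) = vba i j)
    (obb : ∀ i j, (e k n 0 ⊗ₜ 1) * vbb i j * (1 ⊗ₜ e k n 1) = vbb i j) :
    ∃ D : DoubleBracket k (e k n),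
      (∀ i j, D.br (a k n i) (a k n j) = vaa i j) ∧ (∀ i j, D.br (b k n i) (b k n j) = vbb i j) ∧
      (∀ i j, D.br (a k n i) (b k n j) = vab i j) ∧ ∀ i j, D.br (b k n i) (a k n j) = vba i j := by
  -- `dA i` and `dB i` are to be `{{a_i, -}}` and `{{b_i, -}}`.
  choose dA hA hAe hAa hAb using fun i => exists_isDerivationAlong includeLeft includeRight
    (vaa i) (vab i) (oaa i) (oab i)
  choose dB hB hBe hBa hBb using fun i => exists_isDerivationAlong includeLeft includeRight
    (vba i) (vbb i) (oba i) (obb i)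
  have iA : ∀ x i, (1 ⊗ₜ e k n 1) * dA i x * (e k n 0 ⊗ₜ 1) = dA i x := fun x i =>
    ((hA i).mul_mul (commute_includeRight_includeLeft _)
      fun y => (commute_includeRight_includeLeft _ _).symm).ext_arrows (hA i)
      (fun s => by rw [hAe, mul_zero, zero_mul])
      (fun j => by rw [hAa]; exact inner_of_outer (saa j i) (oaa j i))
      (fun j => by rw [hAb]; exact inner_of_outer (eq_neg_comm_symm (sab i j)) (oba j i)) x
  have iB : ∀ x i, (1 ⊗ₜ e k n 0) * dB i x * (e k n 1 ⊗ₜ 1) = dB i x := fun x i =>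
    ((hB i).mul_mul (commute_includeRight_includeLeft _)
      fun y => (commute_includeRight_includeLeft _ _).symm).ext_arrows (hB i)
      (fun s => by rw [hBe, mul_zero, zero_mul])
      (fun j => by rw [hBa]; exact inner_of_outer (sab j i) (oab j i))
      (fun j => by rw [hBb]; exact inner_of_outer (sbb j i) (obb j i)) x
  -- `d x` is to be `{{-, x}}`.
  choose d hd hde hda hdb using fun x => exists_isDerivationAlong includeRight includeLeft
    (fun i => dA i x) (fun i => dB i x) (iA x) (iB x)
  have hadd : ∀ x y z, d (x + y) z = d x z + d y z := fun x y z =>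
    (hd (x + y)).ext_arrows ((hd x).add (hd y)) (fun s => by simp only [hde, add_zero])
      (fun i => by simp only [hda, (hA i).map_add]) (fun i => by simp only [hdb, (hB i).map_add]) z
  have hsmul : ∀ (c : k) x z, d (c • x) z = c • d x z := fun c x z =>
    (hd (c • x)).ext_arrows ((hd x).const_smul c) (fun s => by simp only [hde, smul_zero])
      (fun i => by simp only [hda, (hA i).map_smul])
      (fun i => by simp only [hdb, (hB i).map_smul]) z
  have hmul : ∀ x y z, d (x * y) z = (x ⊗ₜ 1) * d y z + d x z * (1 ⊗ₜ y) := fun x y z => by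
    have h1 := (hd y).mul_mul (u := x ⊗ₜ 1) (v := 1)
      (fun w => (commute_includeRight_includeLeft _ _).symm) (fun w => Commute.one_left _)
    have h2 := (hd x).mul_mul (u := 1) (v := 1 ⊗ₜ y)
      (fun w => Commute.one_left _) (fun w => commute_includeRight_includeLeft _ _)
    have := (hd (x * y)).ext_arrows (h1.add h2)
      (fun s => by simp only [hde, mul_zero, zero_mul, add_zero])
      (fun i => by simp only [hda, (hA i).map_mul, mul_one, one_mul]; rfl)
      (fun i => by simp only [hdb, (hB i).map_mul, mul_one, one_mul]; rfl) z
    simpa only [mul_one, one_mul] using this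
  have hd' : ∀ z, IsDerivationAlong (includeLeft : BoalchAlgebra k n →ₐ[k] _) includeRight
      (fun x => d x z) := fun z => ⟨fun x y => hadd x y z, fun c x => hsmul c x z,
        fun x y => hmul x y z⟩
  have hd0 : ∀ s z, d (e k n s) z = 0 := fun s z =>
    (hd (e k n s)).eq_zero (hde _) (fun i => by rw [hda, hAe]) (fun i => by rw [hdb, hBe]) z
  have hanti : ∀ x z, d x z = -TensorProduct.comm k _ _ (d z x) := fun x z => by
    refine (hd' z).ext_arrows (hd z).neg_comm (fun s => ?_) (fun i => ?_) (fun i => ?_) x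
    · rw [hd0, hde]
      exact zero_eq_neg_comm
    · rw [hda]
      refine eq_neg_comm_symm ((hA i).ext_arrows (hd (a k n i)).neg_comm (fun s => ?_)
        (fun j => ?_) (fun j => ?_) z)
      · rw [hAe, hde]
        exact zero_eq_neg_comm
      · rw [hAa, hda, hAa, ← saa]
      · rw [hAb, hdb, hBa, ← sab]
    · rw [hdb]
      refine eq_neg_comm_symm ((hB i).ext_arrows (hd (b k n i)).neg_comm (fun s => ?_)
        (fun j => ?_) (fun j => ?_) z)
      · rw [hBe, hde]
        exact zero_eq_neg_comm
      · rw [hBa, hda, hAb]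
        exact eq_neg_comm_symm (sab j i)
      · rw [hBb, hdb, hBb, ← sbb]
  let br : BoalchAlgebra k n →ₗ[k] BoalchAlgebra k n →ₗ[k]
      BoalchAlgebra k n ⊗[k] BoalchAlgebra k n :=
    LinearMap.mk₂ k (fun z x => d x z) (fun x y z => (hd z).map_add x y)
      (fun c x z => (hd z).map_smul c x) (fun x y z => hadd y z x) (fun c x z => hsmul c z x)
  have hbr : ∀ x y, br x y = d y x := fun _ _ => rfl
  refine ⟨⟨br, fun x y => ?_, fun x y z => ?_, fun x y hy => ?_⟩, fun i j => ?_, fun i j => ?_,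
    fun i j => ?_, fun i j => ?_⟩
  · rw [hbr, hbr, hanti]
  · rw [hbr, hbr, hbr, hmul, add_comm]
  · suffices h : Submodule.span k (Set.range (e k n)) ≤ LinearMap.ker (br x) from h hy
    rw [Submodule.span_le]
    rintro _ ⟨s, rfl⟩
    exact hd0 s x
  · exact (hda _ i).trans (hAa i j)
  · exact (hdb _ i).trans (hBb i j)
  · exact (hda _ i).trans (hAb i j)
  · exact (hdb _ i).trans (hBa i j)

theorem exists_isEulerBracket (k : Type*) [Field k] (n : ℕ) :
    ∃ D : DoubleBracket k (e k n), IsEulerBracket k n D := by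
  simp only [isEulerBracket_iff]
  have h00 : e k n 0 * e k n 0 = e k n 0 := by simp [e_mul_e]
  have h11 : e k n 1 * e k n 1 = e k n 1 := by simp [e_mul_e]
  refine exists_doubleBracket _ _ _ _ ?_ ?_ ?_ ?_ ?_ ?_ ?_
  · intro i j
    rw [sgnDiff_symm]
    simp only [map_add, map_smul, TensorProduct.comm_tmul]
    module
  · intro i j
    simp only [map_add, map_smul, TensorProduct.comm_tmul]
    module
  · intro i j
    rw [sgnDiff_symm]
    simp only [map_add, map_smul, TensorProduct.comm_tmul]
    module
  all_goals
    intro i j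
    simp only [mul_add, add_mul, mul_smul_comm, smul_mul_assoc, tmul_mul_tmul, one_mul, mul_one,
      e_mul_a, e_mul_b, a_mul_e, b_mul_e, h00, h11, mul_assoc, ← mul_assoc (e k n _) (a k n _),
      ← mul_assoc (e k n _) (b k n _)]

end Existence

/-! ### The Hamiltonian structure -/

section Hamiltonian

variable {k : Type*} [Field k] {n : ℕ}

open BoalchAlgebra Algebra.TensorProduct

theorem IsEulerBracket.eulerSystem {D : DoubleBracket k (e k n)} (h : IsEulerBracket k n D) :
    EulerSystem D n (extendZero (a k n)) (extendZero (b k n)) := by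
  obtain ⟨haa, hbb, hab, -⟩ := (isEulerBracket_iff D).mp h
  exact
    { idem := completeOrthogonalIdempotents k n
      e_a := mul_extendZero (e_mul_a k n)
      a_e := extendZero_mul (a_mul_e k n)
      e_b := mul_extendZero (e_mul_b k n)
      b_e := extendZero_mul (b_mul_e k n)
      br_aa := fun i hi j hj => by
        rw [extendZero_of_lt _ hi, extendZero_of_lt _ hj, haa]
      br_bb := fun i hi j hj => by
        rw [extendZero_of_lt _ hi, extendZero_of_lt _ hj, hbb]
      br_ab := fun i hi j hj => by
        rw [extendZero_of_lt _ hi, extendZero_of_lt _ hj, hab] }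

/-- An element of the Boalch algebra is an arrow. -/
def IsArrow (x : BoalchAlgebra k n) : Prop := (∃ i, x = a k n i) ∨ ∃ i, x = b k n i

theorem IsArrow.extendZero {x : BoalchAlgebra k n} (hx : IsArrow x) :
    (∃ i < n, x = extendZero (a k n) i) ∨ ∃ i < n, x = Boalch.extendZero (b k n) i := by
  obtain ⟨i, rfl⟩ | ⟨i, rfl⟩ := hx
  · exact Or.inl ⟨i, i.2, (extendZero_coe _ i).symm⟩
  · exact Or.inr ⟨i, i.2, (extendZero_coe _ i).symm⟩

theorem IsEulerBracket.triple_eq [CharZero k] {D : DoubleBracket k (e k n)}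
    (h : IsEulerBracket k n D) (x y z : BoalchAlgebra k n) :
    D.triple x y z = tripleQP k (e k n) x y z := by
  -- Both sides are derivations in the last argument, hence, by cyclicity, in each argument.
  have key : ∀ x y, (∀ z, IsArrow z → D.triple x y z = tripleQP k (e k n) x y z) →
      ∀ z, D.triple z x y = tripleQP k (e k n) z x y := fun x y hxy z => by
    refine triple_eq_tripleQP_cyclic ((D.isDerivationAlong_triple x y).ext_arrows
      (isDerivationAlong_tripleQP x y) (fun s => ?_) (fun i => hxy _ (Or.inl ⟨i, rfl⟩))
      (fun i => hxy _ (Or.inr ⟨i, rfl⟩)) z)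
    rw [D.triple_e, tripleQP_e (completeOrthogonalIdempotents k n).toOrthogonalIdempotents]
  refine key y z (fun x hx => ?_) x
  refine key z x (fun y hy => ?_) y
  refine key x y (fun z hz => ?_) z
  exact h.eulerSystem.triple_generators hx.extendZero hy.extendZero hz.extendZero

/-- The moment map identity for `{{Φ, -}}` at the vertex `s` holds if it holds on arrows. -/
theorem momentMap_of_arrows (D : DoubleBracket k (e k n)) {Φ : BoalchAlgebra k n} {s : Fin 2}
    (hl : e k n s * Φ = Φ) (hr : Φ * e k n s = Φ)
    (h : ∀ x, IsArrow x → D.br Φ x = (1 / 2 : k) • ((x * e k n s) ⊗ₜ[k] Φ - e k n s ⊗ₜ[k] (Φ * x)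
      + (x * Φ) ⊗ₜ[k] e k n s - Φ ⊗ₜ[k] (e k n s * x))) (x : BoalchAlgebra k n) :
    D.br Φ x = (1 / 2 : k) • ((x * e k n s) ⊗ₜ[k] Φ - e k n s ⊗ₜ[k] (Φ * x)
      + (x * Φ) ⊗ₜ[k] e k n s - Φ ⊗ₜ[k] (e k n s * x)) := by
  have hinner : ∀ x : BoalchAlgebra k n, (1 / 2 : k) • ((x * e k n s) ⊗ₜ[k] Φ -
      e k n s ⊗ₜ[k] (Φ * x) + (x * Φ) ⊗ₜ[k] e k n s - Φ ⊗ₜ[k] (e k n s * x)) =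
      (1 / 2 : k) • (includeLeft (R := k) (S := k) x * (e k n s ⊗ₜ[k] Φ + Φ ⊗ₜ[k] e k n s) -
        (e k n s ⊗ₜ[k] Φ + Φ ⊗ₜ[k] e k n s) * includeRight (R := k) x) := fun x => by
    simp only [includeLeft_apply, includeRight_apply, mul_add, add_mul, tmul_mul_tmul, one_mul,
      mul_one]
    congr 1
    abel
  simp only [hinner] at h ⊢
  refine (D.isDerivationAlong_br Φ).ext_arrows
    ((IsDerivationAlong.inner includeLeft includeRight _).const_smul (1 / 2 : k))
    (fun t => ?_) (fun i => h _ (Or.inl ⟨i, rfl⟩)) (fun i => h _ (Or.inr ⟨i, rfl⟩)) x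
  rw [D.br_e, ← hinner, ← hl, ← hr]
  by_cases hst : s = t
  · subst hst
    simp only [mul_assoc, e_mul_e, if_pos, ← mul_assoc (e k n s) (e k n s)]
    simp
  · have h1 : e k n t * e k n s = 0 := by rw [e_mul_e, if_neg (Ne.symm hst)]
    have h2 : e k n s * e k n t = 0 := by rw [e_mul_e, if_neg hst]
    simp [mul_assoc, h1, h2, ← mul_assoc (e k n t) (e k n s)]

/-- The local inverse of a moment map component for the opposite double bracket is a moment map
component. -/
theorem momentMap_of_inverse (D : DoubleBracket k (e k n)) {Φ Ψ : BoalchAlgebra k n} {s : Fin 2}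
    (hl : e k n s * Φ = Φ) (hr : Φ * e k n s = Φ) (hΦΨ : Φ * Ψ = e k n s) (hΨΦ : Ψ * Φ = e k n s)
    (h : ∀ x, D.neg.br Ψ x = (1 / 2 : k) • ((x * e k n s) ⊗ₜ[k] Ψ - e k n s ⊗ₜ[k] (Ψ * x)
      + (x * Ψ) ⊗ₜ[k] e k n s - Ψ ⊗ₜ[k] (e k n s * x))) (x : BoalchAlgebra k n) :
    D.br Φ x = (1 / 2 : k) • ((x * e k n s) ⊗ₜ[k] Φ - e k n s ⊗ₜ[k] (Φ * x)
      + (x * Φ) ⊗ₜ[k] e k n s - Φ ⊗ₜ[k] (e k n s * x)) := by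
  have h0 : (1 ⊗ₜ Ψ) * D.br Φ x = D.neg.br Ψ x * (Φ ⊗ₜ 1) := by
    have := D.br_mul_left Ψ Φ x
    rw [hΨΦ, D.br_e_left] at this
    change _ = -D.br Ψ x * _
    rw [neg_mul]
    exact eq_neg_of_add_eq_zero_left this.symm
  have h1 : D.br Φ x = (1 ⊗ₜ Φ) * ((1 ⊗ₜ Ψ) * D.br Φ x) := by
    rw [← mul_assoc, tmul_mul_tmul, one_mul, hΦΨ]
    conv_lhs => rw [← hl, D.br_mul_left, D.br_e_left, zero_mul, add_zero]
  rw [h1, h0, h]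
  simp only [mul_smul_comm, smul_mul_assoc, mul_add, mul_sub, add_mul, sub_mul, tmul_mul_tmul,
    one_mul, mul_one, mul_assoc, hl, hΨΦ, hΦΨ, hr, ← mul_assoc Φ Ψ, ← mul_assoc Φ (e k n s)]
  congr 1
  abel

theorem eulerAB_eq : eulerAB k n =
    evenCont (e k n 1) (extendZero (a k n)) (extendZero (b k n)) n :=
  continuantAB_eq_evenCont_extendZero _ (e_mul_a k n)

theorem eulerBA_eq_evenCont : eulerBA k n = evenCont (e k n 0)
    (fun i => extendZero (b k n) (n - 1 - i)) (fun i => extendZero (a k n) (n - 1 - i)) n := by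
  rw [eulerBA_eq, ← continuantAB_eq_evenCont _ _ _ fun i => mul_extendZero (e_mul_b k n) _]
  have hrev : ∀ i : Fin n, n - 1 - (i : ℕ) = (i.rev : ℕ) := fun i => by
    rw [Fin.val_rev]
    omega
  simp only [hrev, extendZero_coe]

theorem IsEulerBracket.momentMap_eulerAB [CharZero k] {D : DoubleBracket k (e k n)}
    (h : IsEulerBracket k n D) (x : BoalchAlgebra k n) :
    D.br (eulerAB k n) x = (1 / 2 : k) •
      ((x * e k n 1) ⊗ₜ[k] eulerAB k n - e k n 1 ⊗ₜ[k] (eulerAB k n * x)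
      + (x * eulerAB k n) ⊗ₜ[k] e k n 1 - eulerAB k n ⊗ₜ[k] (e k n 1 * x)) := by
  refine momentMap_of_arrows D (e_mul_eulerAB k n) (eulerAB_mul_e k n) (fun x hx => ?_) x
  rw [eulerAB_eq]
  exact h.eulerSystem.br_evenCont_generators hx.extendZero

theorem IsEulerBracket.momentMap_eulerBA [CharZero k] {D : DoubleBracket k (e k n)}
    (h : IsEulerBracket k n D) (x : BoalchAlgebra k n) :
    D.neg.br (eulerBA k n) x = (1 / 2 : k) •
      ((x * e k n 0) ⊗ₜ[k] eulerBA k n - e k n 0 ⊗ₜ[k] (eulerBA k n * x)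
      + (x * eulerBA k n) ⊗ₜ[k] e k n 0 - eulerBA k n ⊗ₜ[k] (e k n 0 * x)) := by
  refine momentMap_of_arrows D.neg (e_mul_eulerBA k n) (eulerBA_mul_e k n) (fun x hx => ?_) x
  rw [eulerBA_eq_evenCont]
  refine h.eulerSystem.swap.br_evenCont_generators ?_
  obtain ⟨i, hi, rfl⟩ | ⟨i, hi, rfl⟩ := hx.extendZero
  · exact Or.inr ⟨n - 1 - i, by omega, by rw [show n - 1 - (n - 1 - i) = i by omega]⟩
  · exact Or.inl ⟨n - 1 - i, by omega, by rw [show n - 1 - (n - 1 - i) = i by omega]⟩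

theorem isUnit_Phi : IsUnit (Phi k n) := by
  have h01 : e k n 0 * e k n 1 = 0 := by simp [e_mul_e]
  have h10 : e k n 1 * e k n 0 = 0 := by simp [e_mul_e]
  have hl0 : e k n 0 * eulerBAInv k n = eulerBAInv k n := e_mul_inv k n 0
  have hr0 : eulerBAInv k n * e k n 0 = eulerBAInv k n := inv_mul_e k n 0
  have hl1 : e k n 1 * eulerABInv k n = eulerABInv k n := e_mul_inv k n 1
  have hr1 : eulerABInv k n * e k n 1 = eulerABInv k n := inv_mul_e k n 1
  have h1 : Phi k n * (eulerABInv k n + eulerBA k n) = 1 := by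
    have h2 : eulerAB k n * eulerBA k n = 0 := by
      rw [← eulerAB_mul_e, ← e_mul_eulerBA, mul_assoc, ← mul_assoc (e k n 1), h10, zero_mul,
        mul_zero]
    have h3 : eulerBAInv k n * eulerABInv k n = 0 := by
      rw [← hr0, ← hl1, mul_assoc, ← mul_assoc (e k n 0), h01, zero_mul, mul_zero]
    rw [Phi, add_mul, mul_add, mul_add, eulerAB_mul_inv, h2, h3, eulerBAInv_mul, add_zero, zero_add,
      add_comm, e_sum]
  have h2 : (eulerABInv k n + eulerBA k n) * Phi k n = 1 := by
    have h2 : eulerBA k n * eulerAB k n = 0 := by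
      rw [← eulerBA_mul_e, ← e_mul_eulerAB, mul_assoc, ← mul_assoc (e k n 0), h01, zero_mul,
        mul_zero]
    have h3 : eulerABInv k n * eulerBAInv k n = 0 := by
      rw [← hr1, ← hl0, mul_assoc, ← mul_assoc (e k n 1), h10, zero_mul, mul_zero]
    rw [Phi, add_mul, mul_add, mul_add, eulerABInv_mul, h2, h3, eulerBA_mul_inv, add_zero, zero_add,
      add_comm, e_sum]
  exact ⟨⟨_, _, h1, h2⟩, rfl⟩

theorem IsEulerBracket.isHamiltonian [CharZero k] {D : DoubleBracket k (e k n)}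
    (h : IsEulerBracket k n D) : IsHamiltonianDoubleQuasiPoisson D (Phi k n) where
  quasiPoisson := ⟨completeOrthogonalIdempotents k n, h.triple_eq⟩
  momentMap := by
    refine ⟨isUnit_Phi, ![eulerBAInv k n, eulerAB k n], ?_, fun s => ?_, fun x s => ?_⟩
    · rw [Phi, Fin.sum_univ_two]
      exact add_comm _ _
    · fin_cases s
      · exact ⟨eulerBAInv k n, by
          change eulerBAInv k n = e k n 0 * eulerBAInv k n * e k n 0
          rw [eulerBAInv, e_mul_inv, inv_mul_e]⟩
      · exact ⟨eulerAB k n, by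
          change eulerAB k n = e k n 1 * eulerAB k n * e k n 1
          rw [e_mul_eulerAB, eulerAB_mul_e]⟩
    · fin_cases s
      · exact momentMap_of_inverse D (e_mul_inv k n 0) (inv_mul_e k n 0) (eulerBAInv_mul k n)
          (eulerBA_mul_inv k n) h.momentMap_eulerBA x
      · exact h.momentMap_eulerAB x

end Hamiltonian

end Boalch

end

theorem theorem3p2 {k : Type*} [Field k] [CharZero k] (n : ℕ) (hn : 1 ≤ n) :
    (∃! D : Boalch.DoubleBracket k (Boalch.BoalchAlgebra.e k n), Boalch.IsEulerBracket k n D) ∧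
    ∀ D : Boalch.DoubleBracket k (Boalch.BoalchAlgebra.e k n), Boalch.IsEulerBracket k n D →
      Boalch.IsHamiltonianDoubleQuasiPoisson D (Boalch.BoalchAlgebra.Phi k n) := by
  obtain ⟨D, hD⟩ := Boalch.exists_isEulerBracket k n
  exact ⟨⟨D, hD, fun D' hD' => hD'.eq hD⟩, fun D hD => hD.isHamiltonian⟩
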